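/- **Setting.** Let $(X,d,\mu)$ be a space of homogeneous type ($d$ a quasi-distance with measurable balls of positive finite measure, $\mu$ doubling). Let $\mathcal D=\bigcup_{j\in\mathbb Z}\mathcal D^j$ be a family of dyadic cubes of Christ type: each $\mathcal D^j$ consists of pairwise disjoint measurable sets covering $X$ up to a $\mu$-null set; if $i<j$, every $Q\in\mathcal D^j$ is contained in exactly one cube of $\mathcal D^i$ and is disjoint from the others; and for some $\rho\in(0,1)$, $a_1,a_2>0$ every $Q\in\mathcal D^j$ satisfies $B(x,a_1\rho^j)\subseteq Q\subseteq B(x,a_2\rho^j)$ for some $x\in Q$. Suppose that $X$ is a quadrant, i.e. any two cubes are contained in a common cube. Let $\mathscr H$ be a Haar system associated to $\mathcal D$: an orthonormal system in $L^2(X,\mu)$ of real functions with integral zero, each $h\in\mathscr H$ being based on a cube $Q(h)\in\mathcal D^{j(h)}$ (it vanishes outside $Q(h)$ and is constant on each child of $Q(h)$, that is, on each cube of $\mathcal D^{j(h)+1}$ contained in $Q(h)$), such that exactly $n-1$ functions are based on a cube with $n$ children. Let $\delta(x,y)=\min\{\mu(Q):Q\in\mathcal D,\ x,y\in Q\}$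 for $x\ne y$ and $\delta(x,x)=0$, and $$D^\beta f(x)=\int_X\frac{f(x)-f(y)}{\delta(x,y)^{1+\beta}}\,d\mu(y).$$ Let $B^\lambda_2(X,\delta,\mu)$ be the space of complex-valued $f\in L^2(X,\mu)$ with $\iint_{X\times X}|f(x)-f(y)|^2\,\delta(x,y)^{-1-2\lambda}\,d\mu(x)\,d\mu(y)<\infty$, and let $P_0$ be the orthogonal projection of $L^2(X,\mu)$ onto the subspace of functions that are $\mu$-a.e. constant on each cube of $\mathcal D^0$. **Theorem.** Let $0<\beta<\lambda<1$ and let $u_0\in B^\lambda_2(X,\delta,\mu)$ with $P_0u_0=0$. For every $h\in\mathscr H$ there is a unique real number $m_h$ with $D^\beta h=m_h\,\mu(Q(h))^{-\beta}h$ $\mu$-a.e., and with these constants put $$u(t)=\sum_{h\in\mathscr H}e^{-itm_h\mu(Q(h))^{-\beta}}\langle u_0,h\rangle\,h .$$ Then: (a) there is $Z\subset X$ with $\mu(Z)=0$ such that for every $x\in X\setminus Z$ and every $t\in[0,1)$ the series defining $u(t)(x)$ converges (unconditionally); (b) $u(t)(x)\to u_0(x)$ as $t\to0^+$ for $\mu$-almost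 every $x\in X$. -/

import Mathlib

open MeasureTheory Filter Topology

namespace DyadicSchrodinger

/-- The ball of a quasi-distance `d`. -/
def qball {X : Type*} (d : X → X → ℝ) (x : X) (r : ℝ) : Set X := {y | d x y < r}

/-- `(X, d, μ)` is a space of homogeneous type: `d` is a quasi-distance, the balls of `d` are
measurable, have positive and finite measure, and `μ` is doubling. -/
structure IsHomogeneousType {X : Type*} [MeasurableSpace X] (d : X → X → ℝ) (μ : Measure X) :
    Prop where
  nonneg : ∀ x y, 0 ≤ d x y
  eq_zero_iff : ∀ x y, d x y = 0 ↔ x = y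
  symm : ∀ x y, d x y = d y x
  quasi_triangle : ∃ K : ℝ, 1 ≤ K ∧ ∀ x y z, d x z ≤ K * (d x y + d y z)
  measurableSet_ball : ∀ x r, MeasurableSet (qball d x r)
  ball_pos : ∀ x r, 0 < r → 0 < μ (qball d x r)
  ball_lt_top : ∀ x r, 0 < r → μ (qball d x r) < ⊤
  doubling : ∃ A : NNReal, ∀ x r, 0 < r → μ (qball d x (2 * r)) ≤ A * μ (qball d x r)

/-- `𝒟 = ⋃ j, 𝒟 j` is a family of dyadic cubes (in the sense of Christ) on `(X, d, μ)`:
`𝒟 j` is the family of the cubes of scale `j`. Cubes are only required to be measurable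
(open sets are measurable here, as they are countable unions of balls), and each
generation covers `X` up to a null set. -/
structure IsDyadicFamily {X : Type*} [MeasurableSpace X] (d : X → X → ℝ) (μ : Measure X)
    (𝒟 : ℤ → Set (Set X)) : Prop where
  measurableSet : ∀ j, ∀ Q ∈ 𝒟 j, MeasurableSet Q
  disjoint : ∀ j, ∀ Q ∈ 𝒟 j, ∀ Q' ∈ 𝒟 j, Q ≠ Q' → Disjoint Q Q'
  covers : ∀ j, μ (⋃₀ 𝒟 j)ᶜ = 0
  parent : ∀ i j, i < j → ∀ Q ∈ 𝒟 j, ∃! P, P ∈ 𝒟 i ∧ Q ⊆ P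
  nested : ∀ i j, i ≤ j → ∀ P ∈ 𝒟 i, ∀ Q ∈ 𝒟 j, Q ⊆ P ∨ Disjoint Q P
  metric_control : ∃ ρ a₁ a₂ : ℝ, 0 < ρ ∧ ρ < 1 ∧ 0 < a₁ ∧ 0 < a₂ ∧
    ∀ j : ℤ, ∀ Q ∈ 𝒟 j, ∃ x ∈ Q, qball d x (a₁ * ρ ^ j) ⊆ Q ∧ Q ⊆ qball d x (a₂ * ρ ^ j)

/-- `X` itself is a quadrant for `𝒟`: any two cubes have a common ancestor. -/
def IsQuadrant {X : Type*} (𝒟 : ℤ → Set (Set X)) : Prop :=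
  ∀ i j, ∀ Q ∈ 𝒟 i, ∀ Q' ∈ 𝒟 j, ∃ k, ∃ P ∈ 𝒟 k, Q ⊆ P ∧ Q' ⊆ P

/-- The offspring of the cube `Q` of scale `j`. -/
def offspring {X : Type*} (𝒟 : ℤ → Set (Set X)) (j : ℤ) (Q : Set X) : Set (Set X) :=
  {Q' | Q' ∈ 𝒟 (j + 1) ∧ Q' ⊆ Q}

/-- A Haar system associated to `𝒟`: an orthonormal system of real functions with vanishing
integral, each `h` being based on a cube `Q(h) = base h` of scale `j(h) = scale h`
(it vanishes off `Q(h)` and is constant on each child of `Q(h)`), such that exactly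
`#(offspring of Q) - 1` functions are based on each cube `Q`. -/
structure HaarSystem {X : Type*} [MeasurableSpace X] (μ : Measure X) (𝒟 : ℤ → Set (Set X)) where
  functions : Set (X → ℝ)
  scale : functions → ℤ
  base : functions → Set X
  base_mem : ∀ h, base h ∈ 𝒟 (scale h)
  measurable : ∀ h : functions, Measurable h.1
  eq_zero_off : ∀ h : functions, ∀ x, x ∉ base h → h.1 x = 0
  const_on_child : ∀ h : functions, ∀ Q' ∈ offspring 𝒟 (scale h) (base h),
    ∀ x ∈ Q', ∀ y ∈ Q', h.1 x = h.1 y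
  integral_eq_zero : ∀ h : functions, ∫ x, h.1 x ∂μ = 0
  normalized : ∀ h : functions, ∫ x, h.1 x ^ 2 ∂μ = 1
  orthogonal : ∀ h h' : functions, h ≠ h' → ∫ x, h.1 x * h'.1 x ∂μ = 0
  card_based : ∀ j, ∀ Q ∈ 𝒟 j,
    {h : functions | scale h = j ∧ base h = Q}.encard + 1 = (offspring 𝒟 j Q).encard

open Classical in
/-- The dyadic distance `δ(x, y)`: the least measure of a cube that contains `x` and `y` if
`x ≠ y`, and `0` if `x = y`. -/
noncomputable def dyadicDist {X : Type*} [MeasurableSpace X] (μ : Measure X)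
    (𝒟 : ℤ → Set (Set X)) (x y : X) : ℝ :=
  if x = y then 0 else sInf {r | ∃ j, ∃ Q ∈ 𝒟 j, x ∈ Q ∧ y ∈ Q ∧ r = μ.real Q}

/-- The dyadic fractional derivative `D^β f` of a real function. -/
noncomputable def fracDeriv {X : Type*} [MeasurableSpace X] (μ : Measure X)
    (𝒟 : ℤ → Set (Set X)) (β : ℝ) (f : X → ℝ) (x : X) : ℝ :=
  ∫ y, (f x - f y) / dyadicDist μ 𝒟 x y ^ (1 + β) ∂μ

/-- `m` is the family of constants with `D^β h = m_h μ(Q(h))^{-β} h` for every Haar function. -/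
def IsHaarMultiplier {X : Type*} [MeasurableSpace X] {μ : Measure X} {𝒟 : ℤ → Set (Set X)}
    (H : HaarSystem μ 𝒟) (β : ℝ) (m : H.functions → ℝ) : Prop :=
  ∀ h : H.functions, ∀ᵐ x ∂μ,
    fracDeriv μ 𝒟 β h.1 x = m h * μ.real (H.base h) ^ (-β) * h.1 x

/-- Membership of `f ∈ L²(X, μ)` in the dyadic Besov space of order `σ`. -/
def MemBesov {X : Type*} [MeasurableSpace X] (μ : Measure X) (𝒟 : ℤ → Set (Set X)) (σ : ℝ)
    (f : Lp ℂ 2 μ) : Prop :=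
  ∫⁻ x, ∫⁻ y, ENNReal.ofReal (‖f x - f y‖ ^ 2 / dyadicDist μ 𝒟 x y ^ (1 + 2 * σ)) ∂μ ∂μ < ⊤

/-- The subspace `V_j` of `L²(X, μ)`: functions which are (a.e.) constant on each cube of
scale `j`. -/
def cubeConst {X : Type*} [MeasurableSpace X] (μ : Measure X) (𝒟 : ℤ → Set (Set X)) (j : ℤ) :
    Submodule ℂ (Lp ℂ 2 μ) where
  carrier := {f | ∀ Q ∈ 𝒟 j, ∃ c : ℂ, ∀ᵐ x ∂μ.restrict Q, f x = c}
  zero_mem' := by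
    intro Q _
    exact ⟨0, ae_restrict_of_ae (Lp.coeFn_zero ℂ 2 μ)⟩
  add_mem' := by
    intro f g hf hg Q hQ
    obtain ⟨a, ha⟩ := hf Q hQ
    obtain ⟨b, hb⟩ := hg Q hQ
    refine ⟨a + b, ?_⟩
    filter_upwards [ha, hb, ae_restrict_of_ae (Lp.coeFn_add f g)] with x h1 h2 h3
    rw [h3, Pi.add_apply, h1, h2]
  smul_mem' := by
    intro k f hf Q hQ
    obtain ⟨a, ha⟩ := hf Q hQ
    refine ⟨k * a, ?_⟩
    filter_upwards [ha, ae_restrict_of_ae (Lp.coeFn_smul k f)] with x h1 h2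
    rw [h2, Pi.smul_apply, h1, smul_eq_mul]

theorem isClosed_cubeConst {X : Type*} [MeasurableSpace X] (μ : Measure X)
    (𝒟 : ℤ → Set (Set X)) (j : ℤ) :
    IsClosed (cubeConst μ 𝒟 j : Set (Lp ℂ 2 μ)) := by
  refine isSeqClosed_iff_isClosed.mp ?_
  intro f g hf hfg Q hQ
  choose c hc using fun n => hf n Q hQ
  obtain ⟨ns, -, hns⟩ := (tendstoInMeasure_of_tendsto_Lp hfg).exists_seq_tendsto_ae
  by_cases h0 : μ.restrict Q = 0
  · exact ⟨0, by rw [h0]; simp⟩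
  have key : ∀ᵐ x ∂μ.restrict Q, Tendsto (fun n => c (ns n)) atTop (𝓝 (g x)) := by
    filter_upwards [ae_restrict_of_ae hns, ae_all_iff.mpr hc] with x h1 h2
    simpa only [h2] using h1
  have : (ae (μ.restrict Q)).NeBot := ae_neBot.mpr h0
  obtain ⟨x₀, hx₀⟩ := key.exists
  refine ⟨g x₀, ?_⟩
  filter_upwards [key] with x hx
  exact tendsto_nhds_unique hx hx₀

instance hasOrthogonalProjection_cubeConst {X : Type*} [MeasurableSpace X] (μ : Measure X)
    (𝒟 : ℤ → Set (Set X)) (j : ℤ) : (cubeConst μ 𝒟 j).HasOrthogonalProjection :=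
  have : CompleteSpace (cubeConst μ 𝒟 j) := (isClosed_cubeConst μ 𝒟 j).completeSpace_coe
  inferInstance

/-- `P_j`, the orthogonal projection of `L²(X, μ)` onto `V_j`. -/
noncomputable def proj {X : Type*} [MeasurableSpace X] (μ : Measure X) (𝒟 : ℤ → Set (Set X))
    (j : ℤ) : Lp ℂ 2 μ →L[ℂ] Lp ℂ 2 μ :=
  (cubeConst μ 𝒟 j).starProjection

/-- The term with index `h` of the Haar series of `u(t)` at the point `x`:
`e^{-i t m_h μ(Q(h))^{-β}} ⟨u₀, h⟩ h(x)`. -/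
noncomputable def solTerm {X : Type*} [MeasurableSpace X] {μ : Measure X} {𝒟 : ℤ → Set (Set X)}
    (H : HaarSystem μ 𝒟) (β : ℝ) (m : H.functions → ℝ) (u₀ : Lp ℂ 2 μ) (t : ℝ) (x : X)
    (h : H.functions) : ℂ :=
  Complex.exp (-Complex.I * ((t * m h * μ.real (H.base h) ^ (-β) : ℝ) : ℂ)) *
    (∫ y, u₀ y * (h.1 y : ℂ) ∂μ) * (h.1 x : ℂ)

/-- The sum `u(t)(x)` of the Haar series. -/
noncomputable def sol {X : Type*} [MeasurableSpace X] {μ : Measure X} {𝒟 : ℤ → Set (Set X)}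
    (H : HaarSystem μ 𝒟) (β : ℝ) (m : H.functions → ℝ) (u₀ : Lp ℂ 2 μ) (t : ℝ) (x : X) : ℂ :=
  ∑' h : H.functions, solTerm H β m u₀ t x h

end DyadicSchrodinger

/-! # Pointwise convergence to the initial datum for the dyadic Schrödinger equation

Write `a_h = ⟨u₀, h⟩`. The phases have modulus one, so the series of `u(t)(x)` is dominated, for
all `t` at once, by `∑ |a_h| |h(x)|`. Both conclusions follow from two facts that hold for almost
every `x`: this series converges, and `∑ a_h h(x) = u₀(x)`; the limit `t → 0⁺` is then taken
by dominated convergence.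

*Absolute convergence.* The projection of `u₀` being zero, only Haar functions of scale at least
`0` contribute. For `w = μ(Q(h))^{2λ}` one has `|a_h h(x)| ≤ |a_h h(x)|² / w + w`. The terms `w`
of the `h` with `x ∈ Q(h)` have a finite sum (`HaarSystem.tsum_rpow_lt_top`): a cube is the base
of a bounded number of Haar functions, and if there is one, then it has at least two children,
each of which is smaller by a fixed factor because of doubling, so that `w` is at most a multiple
of the decrease of `μ(Q)^{2λ}`, and the sum telescopes. The terms `|a_h h(x)|² / w` are summable
almost everywhere since, `h` being normalized, their integral is `∑ |a_h|² μ(Q(h))^{-2λ}`, which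
is bounded by a multiple of the squared Besov seminorm (`HaarSystem.tsum_coeff_lt_top`):
`μ(Q) a_h` is half the double integral of `(u₀(x) - u₀(y)) (h(x) - h(y))` over `Q × Q`, the second
factor is zero unless `x` and `y` are in different children of `Q`, where `δ(x, y) = μ(Q)`, and
the sets of such pairs are disjoint for different `Q`.

*The sum.* On one cube the Haar functions and the constants span the functions that are constant
on the children, so the part of scale `j` of the Haar series at `x` is the difference of the
averages of `u₀` over consecutive cubes around `x` (`HaarSystem.hasSum_scale`). The partial sums are
therefore averages, and these tend to `u₀(x)` wherever
`∫ |u₀(x) - u₀(y)|² δ(x, y)^{-1-2λ} dμ(y)` is finite (`IsCubeChain.tendsto_average`). No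
differentiation theorem is used; none is available, as the σ-algebra may be larger than the one
generated by the cubes.

*The multipliers.* If `x` is in a child `Q'` of `Q = Q(h)`, then `δ(x, y) = μ(Q)` for
`y ∈ Q \ Q'`, and `δ(x, ·)` does not depend on `x ∈ Q` outside `Q`; as `h` has integral zero, this
gives `D^β h = (μ(Q)^{-β} + ∫_{X \ Q} δ(x, y)^{-1-β} dμ(y)) h`, where the integral is finite by
another telescoping sum (`IsCubeChain.integrableOn_compl`).
-/

namespace DyadicSchrodinger

variable {X : Type*} [MeasurableSpace X] {d : X → X → ℝ} {μ : Measure X} {𝒟 : ℤ → Set (Set X)}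

/-! ### Cubes, their measures and their offspring -/

theorem IsHomogeneousType.sigmaFinite (hX : IsHomogeneousType d μ) : SigmaFinite μ := by
  rcases isEmpty_or_nonempty X with hE | ⟨⟨x₀⟩⟩
  · have : μ = 0 := Measure.eq_zero_of_isEmpty μ
    rw [this]
    infer_instance
  · refine ⟨⟨⟨fun n => qball d x₀ (n + 1), fun _ => trivial,
      fun n => hX.ball_lt_top _ _ (by positivity), ?_⟩⟩⟩
    refine Set.eq_univ_of_forall fun y => Set.mem_iUnion.2 ?_
    obtain ⟨n, hn⟩ := exists_nat_gt (d x₀ y)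
    exact ⟨n, show d x₀ y < n + 1 by linarith⟩

theorem IsDyadicFamily.nonempty (h𝒟 : IsDyadicFamily d μ 𝒟) {j : ℤ} {Q : Set X} (hQ : Q ∈ 𝒟 j) :
    Q.Nonempty := by
  obtain ⟨ρ, a₁, a₂, -, -, -, -, h⟩ := h𝒟.metric_control
  obtain ⟨x, hx, -⟩ := h j Q hQ
  exact ⟨x, hx⟩

theorem IsDyadicFamily.measure_pos (h𝒟 : IsDyadicFamily d μ 𝒟) (hX : IsHomogeneousType d μ)
    {j : ℤ} {Q : Set X} (hQ : Q ∈ 𝒟 j) : 0 < μ Q := by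
  obtain ⟨ρ, a₁, a₂, hρ, -, ha₁, -, h⟩ := h𝒟.metric_control
  obtain ⟨x, -, hx, -⟩ := h j Q hQ
  exact (hX.ball_pos x _ (by positivity)).trans_le (measure_mono hx)

theorem IsDyadicFamily.measure_lt_top (h𝒟 : IsDyadicFamily d μ 𝒟) (hX : IsHomogeneousType d μ)
    {j : ℤ} {Q : Set X} (hQ : Q ∈ 𝒟 j) : μ Q < ⊤ := by
  obtain ⟨ρ, a₁, a₂, hρ, -, -, ha₂, h⟩ := h𝒟.metric_control
  obtain ⟨x, -, -, hx⟩ := h j Q hQ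
  exact (measure_mono hx).trans_lt (hX.ball_lt_top x _ (by positivity))

theorem IsDyadicFamily.measureReal_pos (h𝒟 : IsDyadicFamily d μ 𝒟) (hX : IsHomogeneousType d μ)
    {j : ℤ} {Q : Set X} (hQ : Q ∈ 𝒟 j) : 0 < μ.real Q :=
  ENNReal.toReal_pos (h𝒟.measure_pos hX hQ).ne' (h𝒟.measure_lt_top hX hQ).ne

theorem IsDyadicFamily.eq_of_mem (h𝒟 : IsDyadicFamily d μ 𝒟) {j : ℤ} {Q Q' : Set X} {x : X}
    (hQ : Q ∈ 𝒟 j) (hQ' : Q' ∈ 𝒟 j) (hx : x ∈ Q) (hx' : x ∈ Q') : Q = Q' := by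
  by_contra hne
  exact Set.disjoint_left.1 (h𝒟.disjoint j Q hQ Q' hQ' hne) hx hx'

theorem IsDyadicFamily.subset_of_mem (h𝒟 : IsDyadicFamily d μ 𝒟) {i j : ℤ} (hij : i ≤ j)
    {P Q : Set X} {x : X} (hP : P ∈ 𝒟 i) (hQ : Q ∈ 𝒟 j) (hxP : x ∈ P) (hxQ : x ∈ Q) :
    Q ⊆ P :=
  (h𝒟.nested i j hij P hP Q hQ).resolve_right fun h => Set.disjoint_left.1 h hxQ hxP

theorem IsDyadicFamily.countable (h𝒟 : IsDyadicFamily d μ 𝒟) (hX : IsHomogeneousType d μ)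
    (j : ℤ) : (𝒟 j).Countable := by
  have := hX.sigmaFinite
  have h := Measure.countable_meas_pos_of_disjoint_iUnion (μ := μ)
    (As := fun Q : 𝒟 j => (Q : Set X)) (fun Q => h𝒟.measurableSet j Q Q.2)
    (fun Q Q' hne => h𝒟.disjoint j Q Q.2 Q' Q'.2 (Subtype.coe_injective.ne hne))
  have huniv : {Q : 𝒟 j | 0 < μ (Q : Set X)} = Set.univ :=
    Set.eq_univ_of_forall fun Q => h𝒟.measure_pos hX Q.2
  rw [huniv] at h
  exact Set.countable_coe_iff.1 (Set.countable_univ_iff.1 h)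

/-- By doubling, a cube and each of its children have comparable measures. -/
theorem IsDyadicFamily.exists_le_mul_offspring (h𝒟 : IsDyadicFamily d μ 𝒟)
    (hX : IsHomogeneousType d μ) :
    ∃ C : ℝ, 1 ≤ C ∧ ∀ j, ∀ Q ∈ 𝒟 j, ∀ Q' ∈ offspring 𝒟 j Q, μ.real Q ≤ C * μ.real Q' := by
  obtain ⟨ρ, a₁, a₂, hρ, -, ha₁, ha₂, h⟩ := h𝒟.metric_control
  obtain ⟨A, hA⟩ := hX.doubling
  obtain ⟨K, hK, htri⟩ := hX.quasi_triangle
  have hiter : ∀ n : ℕ, ∀ x r, 0 < r → μ (qball d x (2 ^ n * r)) ≤ A ^ n * μ (qball d x r) := by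
    intro n
    induction n with
    | zero => intro x r _; simp
    | succ n ih =>
      intro x r hr
      calc μ (qball d x (2 ^ (n + 1) * r)) = μ (qball d x (2 * (2 ^ n * r))) := by
            rw [pow_succ]; ring_nf
        _ ≤ A * μ (qball d x (2 ^ n * r)) := hA _ _ (by positivity)
        _ ≤ A * (A ^ n * μ (qball d x r)) := by gcongr; exact ih x r hr
        _ = A ^ (n + 1) * μ (qball d x r) := by rw [pow_succ]; ring
  obtain ⟨n, hn⟩ := pow_unbounded_of_one_lt (2 * K * a₂ / (a₁ * ρ)) (one_lt_two (α := ℝ))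
  refine ⟨max 1 ((A : ℝ) ^ n), le_max_left _ _, fun j Q hQ Q' hQ' => ?_⟩
  obtain ⟨x, hx, -, hxQ⟩ := h j Q hQ
  obtain ⟨x', hx', hxQ', -⟩ := h (j + 1) Q' hQ'.1
  have hρj : 0 < ρ ^ j := zpow_pos hρ j
  have hsub : Q ⊆ qball d x' (2 ^ n * (a₁ * ρ ^ (j + 1))) := by
    intro y hy
    have h1 : d x y < a₂ * ρ ^ j := hxQ hy
    have h2 : d x' x < a₂ * ρ ^ j := by rw [hX.symm]; exact hxQ (hQ'.2 hx')
    have h3 := htri x' x y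
    have h4 : 2 * K * a₂ < 2 ^ n * (a₁ * ρ) := (div_lt_iff₀ (by positivity)).1 hn
    change d x' y < _
    calc d x' y ≤ K * (d x' x + d x y) := h3
      _ ≤ K * (a₂ * ρ ^ j + a₂ * ρ ^ j) := by gcongr
      _ = 2 * K * a₂ * ρ ^ j := by ring
      _ < 2 ^ n * (a₁ * ρ) * ρ ^ j := by gcongr
      _ = 2 ^ n * (a₁ * ρ ^ (j + 1)) := by rw [zpow_add_one₀ hρ.ne']; ring
  have hle : μ Q ≤ A ^ n * μ Q' :=
    (measure_mono hsub).trans ((hiter n x' _ (by positivity)).trans (by gcongr))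
  have hle' : μ.real Q ≤ (A : ℝ) ^ n * μ.real Q' := by
    have := ENNReal.toReal_mono
      (ENNReal.mul_ne_top (by simp) (h𝒟.measure_lt_top hX hQ'.1).ne) hle
    simpa [Measure.real, ENNReal.toReal_mul] using this
  exact hle'.trans (by gcongr; exact le_max_right _ _)

theorem IsDyadicFamily.disjoint_offspring (h𝒟 : IsDyadicFamily d μ 𝒟) {j : ℤ} {Q : Set X} :
    (offspring 𝒟 j Q).PairwiseDisjoint id :=
  fun _ h₁ _ h₂ hne => h𝒟.disjoint (j + 1) _ h₁.1 _ h₂.1 hne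

/-- The number of children of a cube is bounded. -/
theorem IsDyadicFamily.exists_encard_offspring_le (h𝒟 : IsDyadicFamily d μ 𝒟)
    (hX : IsHomogeneousType d μ) :
    ∃ N : ℕ, ∀ j, ∀ Q ∈ 𝒟 j, (offspring 𝒟 j Q).encard ≤ N := by
  obtain ⟨C, hC1, hC⟩ := h𝒟.exists_le_mul_offspring hX
  obtain ⟨N, hN⟩ := exists_nat_gt C
  refine ⟨N, fun j Q hQ => ?_⟩
  by_contra hlt
  obtain ⟨t, ht, htN⟩ := Set.exists_subset_encard_eq (not_le.1 hlt).le
  have htfin : t.Finite := Set.finite_of_encard_eq_coe htN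
  have hQpos := h𝒟.measureReal_pos hX hQ
  have hcard : htfin.toFinset.card = N := by
    have := htfin.encard_eq_coe_toFinset_card
    rw [htN] at this
    exact_mod_cast this.symm
  have hsum : ∑ Q' ∈ htfin.toFinset, μ.real Q' ≤ μ.real Q := by
    have hdisj : Set.PairwiseDisjoint (htfin.toFinset : Set (Set X)) id := by
      rw [htfin.coe_toFinset]
      exact h𝒟.disjoint_offspring.subset ht
    have := measureReal_biUnion_finset (μ := μ) (f := id) hdisj
      (fun Q' hQ' => h𝒟.measurableSet (j + 1) Q' (ht (htfin.mem_toFinset.1 hQ')).1)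
      (fun Q' hQ' => (h𝒟.measure_lt_top hX (ht (htfin.mem_toFinset.1 hQ')).1).ne)
    simp only [id] at this
    rw [← this]
    exact measureReal_mono
      (Set.iUnion₂_subset fun Q' hQ' => (ht (htfin.mem_toFinset.1 hQ')).2)
      (h𝒟.measure_lt_top hX hQ).ne
  have hlow : ∑ Q' ∈ htfin.toFinset, μ.real Q / C ≤ ∑ Q' ∈ htfin.toFinset, μ.real Q' :=
    Finset.sum_le_sum fun Q' hQ' => (div_le_iff₀' (by linarith)).2
      (hC j Q hQ Q' (ht (htfin.mem_toFinset.1 hQ')))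
  rw [Finset.sum_const, hcard, nsmul_eq_mul] at hlow
  have h1 := hlow.trans hsum
  rw [← mul_div_assoc, div_le_iff₀ (by linarith)] at h1
  nlinarith

/-- A cube with at least two children loses a fixed fraction of its measure when passing to any
of its children. -/
theorem IsDyadicFamily.exists_offspring_le_mul (h𝒟 : IsDyadicFamily d μ 𝒟)
    (hX : IsHomogeneousType d μ) :
    ∃ θ : ℝ, 0 ≤ θ ∧ θ < 1 ∧ ∀ j, ∀ Q ∈ 𝒟 j, (offspring 𝒟 j Q).Nontrivial →
      ∀ Q' ∈ offspring 𝒟 j Q, μ.real Q' ≤ θ * μ.real Q := by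
  obtain ⟨C, hC1, hC⟩ := h𝒟.exists_le_mul_offspring hX
  have hC0 : 0 < C := by linarith
  refine ⟨1 - C⁻¹, ?_, ?_, fun j Q hQ hnt Q' hQ' => ?_⟩
  · have := inv_le_one_of_one_le₀ hC1
    linarith
  · have := inv_pos.2 hC0
    linarith
  obtain ⟨R, hR, hne⟩ := hnt.exists_ne Q'
  have hdisj := h𝒟.disjoint (j + 1) Q' hQ'.1 R hR.1 hne.symm
  have h1 : μ.real Q' + μ.real R ≤ μ.real Q := by
    rw [← measureReal_union hdisj (h𝒟.measurableSet _ R hR.1)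
      (h𝒟.measure_lt_top hX hQ'.1).ne (h𝒟.measure_lt_top hX hR.1).ne]
    exact measureReal_mono (Set.union_subset hQ'.2 hR.2) (h𝒟.measure_lt_top hX hQ).ne
  have h2 : C⁻¹ * μ.real Q ≤ μ.real R := by
    rw [inv_mul_le_iff₀ hC0]
    exact hC j Q hQ R hR
  linarith

/-- Distinct points lie in different cubes at all fine enough scales. -/
theorem IsDyadicFamily.exists_scale_separating (h𝒟 : IsDyadicFamily d μ 𝒟)
    (hX : IsHomogeneousType d μ) {x y : X} (hxy : x ≠ y) :
    ∃ J : ℕ, ∀ Q ∈ 𝒟 J, x ∈ Q → y ∉ Q := by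
  obtain ⟨ρ, a₁, a₂, hρ, hρ1, -, ha₂, h⟩ := h𝒟.metric_control
  obtain ⟨K, hK, htri⟩ := hX.quasi_triangle
  have hd : 0 < d x y := lt_of_le_of_ne (hX.nonneg x y)
    fun h0 => hxy ((hX.eq_zero_iff x y).1 h0.symm)
  obtain ⟨J, hJ⟩ := exists_pow_lt_of_lt_one (show 0 < d x y / (2 * K * a₂) by positivity) hρ1
  refine ⟨J, fun Q hQ hx hy => ?_⟩
  obtain ⟨c, -, -, hc⟩ := h J Q hQ
  have h1 : d c y < a₂ * ρ ^ J := by simpa using (show d c y < _ from hc hy)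
  have h2 : d x c < a₂ * ρ ^ J := by
    rw [hX.symm]
    simpa using (show d c x < _ from hc hx)
  have h3 : ρ ^ J * (2 * K * a₂) < d x y := (lt_div_iff₀ (by positivity)).1 hJ
  have h4 : K * (d x c + d c y) ≤ K * (a₂ * ρ ^ J + a₂ * ρ ^ J) := by gcongr
  linarith [htri x c y]

/-! ### The chain of cubes containing a point -/

/-- `Q` lists, for each scale, the cube that contains `x`. -/
def IsCubeChain (𝒟 : ℤ → Set (Set X)) (x : X) (Q : ℤ → Set X) : Prop :=
  ∀ j, Q j ∈ 𝒟 j ∧ x ∈ Q j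

theorem IsDyadicFamily.ae_exists_cubeChain (h𝒟 : IsDyadicFamily d μ 𝒟) :
    ∀ᵐ x ∂μ, ∃ Q, IsCubeChain 𝒟 x Q := by
  have h : ∀ j : ℤ, ∀ᵐ x ∂μ, x ∈ ⋃₀ 𝒟 j := fun j => h𝒟.covers j
  filter_upwards [ae_all_iff.2 h] with x hx
  choose Q hQ using hx
  exact ⟨Q, hQ⟩

theorem IsCubeChain.antitone (h𝒟 : IsDyadicFamily d μ 𝒟) {x : X} {Q : ℤ → Set X}
    (hQ : IsCubeChain 𝒟 x Q) : Antitone Q :=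
  fun i j hij => h𝒟.subset_of_mem hij (hQ i).1 (hQ j).1 (hQ i).2 (hQ j).2

theorem IsCubeChain.eq_of_mem (h𝒟 : IsDyadicFamily d μ 𝒟) {x : X} {Q : ℤ → Set X}
    (hQ : IsCubeChain 𝒟 x Q) {j : ℤ} {P : Set X} (hP : P ∈ 𝒟 j) (hx : x ∈ P) : P = Q j :=
  h𝒟.eq_of_mem hP (hQ j).1 hx (hQ j).2

theorem IsCubeChain.offspring (h𝒟 : IsDyadicFamily d μ 𝒟) {x : X} {Q : ℤ → Set X}
    (hQ : IsCubeChain 𝒟 x Q) (j : ℤ) : Q (j + 1) ∈ offspring 𝒟 j (Q j) :=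
  ⟨(hQ (j + 1)).1, hQ.antitone h𝒟 (by lia)⟩

theorem IsCubeChain.iInter_nat (h𝒟 : IsDyadicFamily d μ 𝒟) (hX : IsHomogeneousType d μ) {x : X}
    {Q : ℤ → Set X} (hQ : IsCubeChain 𝒟 x Q) : ⋂ n : ℕ, Q n = {x} := by
  refine Set.eq_singleton_iff_unique_mem.2 ⟨Set.mem_iInter.2 fun n => (hQ n).2, fun y hy => ?_⟩
  by_contra hne
  obtain ⟨J, hJ⟩ := h𝒟.exists_scale_separating hX (Ne.symm hne)
  exact hJ _ (hQ J).1 (hQ J).2 (Set.mem_iInter.1 hy J)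

/-- A point other than `x` in the cube of scale `i` around `x` leaves the chain of cubes around
`x` at a definite scale. -/
theorem IsCubeChain.exists_mem_diff (h𝒟 : IsDyadicFamily d μ 𝒟) (hX : IsHomogeneousType d μ)
    {x y : X} {Q : ℤ → Set X} (hQ : IsCubeChain 𝒟 x Q) (hxy : x ≠ y) {i : ℤ} (hy : y ∈ Q i) :
    ∃ j, i ≤ j ∧ y ∈ Q j \ Q (j + 1) := by
  obtain ⟨J, hJ⟩ := h𝒟.exists_scale_separating hX hxy
  have hJ' : y ∉ Q J := hJ _ (hQ J).1 (hQ J).2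
  by_contra! hcon
  have hall : ∀ n : ℕ, y ∈ Q (i + n) := by
    intro n
    induction n with
    | zero => simpa using hy
    | succ n ih =>
      have := hcon (i + n) (by lia)
      by_contra hn
      exact this ⟨ih, by push_cast at hn; rwa [← add_assoc] at hn⟩
  exact hJ' (hQ.antitone h𝒟 (by lia) (hall (J - i).toNat))

theorem IsDyadicFamily.ae_exists_offspring (h𝒟 : IsDyadicFamily d μ 𝒟) {j : ℤ} {Q : Set X}
    (hQ : Q ∈ 𝒟 j) : ∀ᵐ x ∂μ, x ∈ Q → ∃ Q' ∈ DyadicSchrodinger.offspring 𝒟 j Q, x ∈ Q' := by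
  filter_upwards [h𝒟.ae_exists_cubeChain] with x ⟨R, hR⟩ hx
  have := hR.offspring h𝒟 j
  rw [← hR.eq_of_mem h𝒟 hQ hx] at this
  exact ⟨_, this, (hR _).2⟩

/-! ### The dyadic distance -/

theorem dyadicDist_le {j : ℤ} {Q : Set X} (hQ : Q ∈ 𝒟 j) {x y : X} (hx : x ∈ Q) (hy : y ∈ Q) :
    dyadicDist μ 𝒟 x y ≤ μ.real Q := by
  unfold dyadicDist
  split_ifs
  · exact measureReal_nonneg
  · refine csInf_le ⟨0, ?_⟩ ⟨j, Q, hQ, hx, hy, rfl⟩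
    rintro r ⟨j, Q, -, -, -, rfl⟩
    exact measureReal_nonneg

/-- If a child of `Q` contains `x` but not `y ∈ Q`, then `Q` is the smallest cube that contains
`x` and `y`. -/
theorem IsDyadicFamily.dyadicDist_eq (h𝒟 : IsDyadicFamily d μ 𝒟) (hX : IsHomogeneousType d μ)
    {j : ℤ} {Q Q' : Set X} (hQ : Q ∈ 𝒟 j) (hQ' : Q' ∈ offspring 𝒟 j Q) {x y : X} (hx : x ∈ Q')
    (hy : y ∈ Q \ Q') : dyadicDist μ 𝒟 x y = μ.real Q := by
  refine le_antisymm (dyadicDist_le hQ (hQ'.2 hx) hy.1) ?_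
  have hne : x ≠ y := fun h => hy.2 (h ▸ hx)
  rw [dyadicDist, if_neg hne]
  refine le_csInf ⟨_, j, Q, hQ, hQ'.2 hx, hy.1, rfl⟩ ?_
  rintro r ⟨i, P, hP, hxP, hyP, rfl⟩
  rcases le_or_gt i j with hij | hij
  · exact measureReal_mono (h𝒟.subset_of_mem hij hP hQ hxP (hQ'.2 hx))
      (h𝒟.measure_lt_top hX hP).ne
  · exact absurd (h𝒟.subset_of_mem (by lia : j + 1 ≤ i) hQ'.1 hP hx hxP hyP) hy.2

/-- Seen from outside a cube, all points of the cube are at the same dyadic distance. -/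
theorem IsDyadicFamily.dyadicDist_congr (h𝒟 : IsDyadicFamily d μ 𝒟) {j : ℤ} {Q : Set X}
    (hQ : Q ∈ 𝒟 j) {x x' y : X} (hx : x ∈ Q) (hx' : x' ∈ Q) (hy : y ∉ Q) :
    dyadicDist μ 𝒟 x y = dyadicDist μ 𝒟 x' y := by
  have key : ∀ a b, a ∈ Q → b ∈ Q → ∀ i, ∀ P ∈ 𝒟 i, a ∈ P → y ∈ P → b ∈ P := by
    intro a b ha hb i P hP haP hyP
    rcases le_or_gt i j with hij | hij
    · exact h𝒟.subset_of_mem hij hP hQ haP ha hb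
    · exact absurd (h𝒟.subset_of_mem hij.le hQ hP ha haP hyP) hy
  have hne : ∀ a ∈ Q, a ≠ y := fun a ha h => hy (h ▸ ha)
  rw [dyadicDist, dyadicDist, if_neg (hne x hx), if_neg (hne x' hx')]
  congr 1
  ext r
  constructor
  · rintro ⟨i, P, hP, h1, h2, rfl⟩
    exact ⟨i, P, hP, key x x' hx hx' i P hP h1 h2, h2, rfl⟩
  · rintro ⟨i, P, hP, h1, h2, rfl⟩
    exact ⟨i, P, hP, key x' x hx' hx i P hP h1 h2, h2, rfl⟩

theorem dyadicDist_comm (x y : X) : dyadicDist μ 𝒟 x y = dyadicDist μ 𝒟 y x := by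
  rcases eq_or_ne x y with rfl | hne
  · rfl
  rw [dyadicDist, dyadicDist, if_neg hne, if_neg hne.symm]
  congr 1
  ext r
  constructor <;>
  · rintro ⟨i, P, hP, h1, h2, rfl⟩
    exact ⟨i, P, hP, h2, h1, rfl⟩

open Classical in
/-- The infimum of the measures of the cubes containing `x` and `y`, as an extended nonnegative
number. It is jointly measurable, and its real value is `δ(x, y)` off the diagonal; the diagonal
itself need not be measurable in `X × X`. -/
noncomputable def infCubeMeasure (μ : Measure X) (𝒟 : ℤ → Set (Set X)) (x y : X) : ENNReal :=
  ⨅ i : Σ j, 𝒟 j, if (x, y) ∈ (i.2 : Set X) ×ˢ (i.2 : Set X) then μ i.2 else ⊤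

theorem IsDyadicFamily.measurable_infCubeMeasure (h𝒟 : IsDyadicFamily d μ 𝒟)
    (hX : IsHomogeneousType d μ) :
    Measurable (fun p : X × X => infCubeMeasure μ 𝒟 p.1 p.2) := by
  have : ∀ j, Countable (𝒟 j) := fun j => (h𝒟.countable hX j).to_subtype
  classical
  refine Measurable.iInf fun i => ?_
  have hm := h𝒟.measurableSet i.1 i.2 i.2.2
  exact Measurable.ite (hm.prod hm) measurable_const measurable_const

theorem IsDyadicFamily.dyadicDist_eq_toReal (h𝒟 : IsDyadicFamily d μ 𝒟)
    (hX : IsHomogeneousType d μ) {x y : X} (hxy : x ≠ y) :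
    dyadicDist μ 𝒟 x y = (infCubeMeasure μ 𝒟 x y).toReal := by
  classical
  have h1 : infCubeMeasure μ 𝒟 x y
      = sInf {r | ∃ j, ∃ Q ∈ 𝒟 j, x ∈ Q ∧ y ∈ Q ∧ r = μ Q} := by
    refine le_antisymm (le_sInf ?_) (le_iInf fun i => ?_)
    · rintro r ⟨j, Q, hQ, hx, hy, rfl⟩
      exact (iInf_le _ (⟨j, Q, hQ⟩ : Σ j, 𝒟 j)).trans (by simp [hx, hy])
    · split_ifs with h
      · exact sInf_le ⟨i.1, i.2, i.2.2, h.1, h.2, rfl⟩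
      · exact le_top
  rw [h1, ENNReal.toReal_sInf, dyadicDist, if_neg hxy]
  · congr 1
    ext r
    constructor
    · rintro ⟨j, Q, hQ, hx, hy, rfl⟩
      exact ⟨_, ⟨j, Q, hQ, hx, hy, rfl⟩, rfl⟩
    · rintro ⟨_, ⟨j, Q, hQ, hx, hy, rfl⟩, rfl⟩
      exact ⟨j, Q, hQ, hx, hy, rfl⟩
  · rintro r ⟨j, Q, hQ, -, -, rfl⟩
    exact (h𝒟.measure_lt_top hX hQ).ne

/-! ### Haar functions -/

theorem HaarSystem.integrable_sq (H : HaarSystem μ 𝒟) (h : H.functions) :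
    Integrable (fun x => h.1 x ^ 2) μ := by
  by_contra hn
  have := H.normalized h
  rw [integral_undef hn] at this
  exact zero_ne_one this

theorem HaarSystem.memLp (H : HaarSystem μ 𝒟) (h : H.functions) : MemLp h.1 2 μ :=
  (memLp_two_iff_integrable_sq (H.measurable h).aestronglyMeasurable).2 (H.integrable_sq h)

theorem HaarSystem.indicator_base (H : HaarSystem μ 𝒟) (h : H.functions) :
    (H.base h).indicator h.1 = h.1 :=
  Set.indicator_eq_self.2 fun x hx => by
    by_contra hn
    exact hx (H.eq_zero_off h x hn)

theorem HaarSystem.integrable (hX : IsHomogeneousType d μ) (h𝒟 : IsDyadicFamily d μ 𝒟)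
    (H : HaarSystem μ 𝒟) (h : H.functions) : Integrable h.1 μ := by
  have hm := h𝒟.measurableSet _ _ (H.base_mem h)
  have : IsFiniteMeasure (μ.restrict (H.base h)) :=
    ⟨by simpa using h𝒟.measure_lt_top hX (H.base_mem h)⟩
  rw [← H.indicator_base h, integrable_indicator_iff hm]
  exact ((H.memLp h).restrict _).integrable one_le_two

theorem HaarSystem.not_ae_eq_zero (H : HaarSystem μ 𝒟) (h : H.functions) :
    ¬ ∀ᵐ x ∂μ, h.1 x = 0 := by
  intro h0
  have := H.normalized h
  rw [integral_eq_zero_of_ae] at this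
  · exact zero_ne_one this
  · filter_upwards [h0] with x hx
    simp [hx]

/-! ### Haar functions are eigenfunctions of the fractional derivative -/

/-- The left end point minorizes a Riemann sum: `(b - a) b^{-1-β} ≤ ∫_a^b s^{-1-β} ds`. -/
theorem sub_div_rpow_le {a b β : ℝ} (ha : 0 < a) (hab : a ≤ b) (hβ : 0 < β) :
    (b - a) / b ^ (1 + β) ≤ (a ^ (-β) - b ^ (-β)) / β := by
  have hb : 0 < b := ha.trans_le hab
  have ht : 0 < a / b := by positivity
  have h1 : 1 + β * (1 - a / b) ≤ (a / b) ^ (-β) := by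
    rw [Real.rpow_def_of_pos ht]
    nlinarith [Real.add_one_le_exp (Real.log (a / b) * -β), Real.log_le_sub_one_of_pos ht]
  have h2 : a ^ (-β) = (a / b) ^ (-β) * b ^ (-β) := by
    rw [← Real.mul_rpow ht.le hb.le, div_mul_cancel₀ _ hb.ne']
  have hbβ : 0 < b ^ (-β) := Real.rpow_pos_of_pos hb _
  have h3 : (b - a) / b ^ (1 + β) = (1 - a / b) * b ^ (-β) := by
    rw [Real.rpow_add hb, Real.rpow_one, Real.rpow_neg hb.le]
    field_simp
  rw [h3, le_div_iff₀ hβ, h2]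
  nlinarith

/-- The kernel `δ(x, ·)^{-1-β}` is integrable away from any cube around `x`: on the difference of
two consecutive ancestors it is constant, and the integrals there telescope. -/
theorem IsCubeChain.integrableOn_compl (hX : IsHomogeneousType d μ) (h𝒟 : IsDyadicFamily d μ 𝒟)
    (hquad : IsQuadrant 𝒟) {β : ℝ} (hβ : 0 < β) {x : X} {R : ℤ → Set X} (hR : IsCubeChain 𝒟 x R)
    (j : ℤ) : IntegrableOn (fun y => (dyadicDist μ 𝒟 x y ^ (1 + β))⁻¹) (R j)ᶜ μ := by
  set A : ℕ → Set X := fun n => R (j - (n + 1)) \ R (j - n) with hA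
  have hmeas : ∀ i, MeasurableSet (R i) := fun i => h𝒟.measurableSet i _ (hR i).1
  have hfin : ∀ i, μ (R i) ≠ ⊤ := fun i => (h𝒟.measure_lt_top hX (hR i).1).ne
  have hpos : ∀ i, 0 < μ.real (R i) := fun i => h𝒟.measureReal_pos hX (hR i).1
  have hAm : ∀ n, MeasurableSet (A n) := fun n => (hmeas _).diff (hmeas _)
  have hcover : (R j)ᶜ ≤ᵐ[μ] ⋃ n, A n := by
    filter_upwards [h𝒟.ae_exists_cubeChain] with y ⟨S, hS⟩ hy
    obtain ⟨k, P, hP, h1, h2⟩ := hquad j j _ (hR j).1 _ (hS j).1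
    have hyk : y ∈ R k := hR.eq_of_mem h𝒟 hP (h1 (hR j).2) ▸ h2 (hS j).2
    have hxy : x ≠ y := fun h => hy (h ▸ (hR j).2)
    obtain ⟨i, -, hi⟩ := hR.exists_mem_diff h𝒟 hX hxy hyk
    have hij : i < j := by
      by_contra! hle
      exact hy (hR.antitone h𝒟 hle hi.1)
    refine Set.mem_iUnion.2 ⟨(j - 1 - i).toNat, ?_⟩
    have e1 : j - ((j - 1 - i).toNat + 1 : ℤ) = i := by lia
    have e2 : j - ((j - 1 - i).toNat : ℤ) = i + 1 := by lia
    rw [hA]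
    simp only [e1, e2]
    exact hi
  have hval : ∀ n, ∀ y ∈ A n, (dyadicDist μ 𝒟 x y ^ (1 + β))⁻¹
      = (μ.real (R (j - (n + 1))) ^ (1 + β))⁻¹ := by
    intro n y hy
    have hoff := hR.offspring h𝒟 (j - (n + 1))
    have e : j - ((n : ℤ) + 1) + 1 = j - n := by ring
    rw [e] at hoff
    rw [h𝒟.dyadicDist_eq hX (hR _).1 hoff (hR _).2 hy]
  have hAfin : ∀ n, μ (A n) ≠ ⊤ := fun n => measure_ne_top_of_subset Set.sdiff_subset (hfin _)
  refine IntegrableOn.mono_set_ae ?_ hcover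
  refine integrableOn_iUnion_of_summable_integral_norm (fun n => ?_) ?_
  · exact (integrableOn_const (hAfin n)).congr_fun (fun y hy => (hval n y hy).symm) (hAm n)
  · set b : ℕ → ℝ := fun n => μ.real (R (j - n)) with hb
    have hmono : ∀ n, b n ≤ b (n + 1) := fun n =>
      measureReal_mono (hR.antitone h𝒟 (by push_cast; lia)) (hfin _)
    have hint : ∀ n, ∫ y in A n, ‖(dyadicDist μ 𝒟 x y ^ (1 + β))⁻¹‖ ∂μ
        = (b (n + 1) - b n) / b (n + 1) ^ (1 + β) := by
      intro n
      rw [setIntegral_congr_fun (hAm n) (fun y hy => by rw [hval n y hy]), setIntegral_const,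
        measureReal_sdiff (hR.antitone h𝒟 (by lia)) (hmeas _) (hfin _), smul_eq_mul,
        Real.norm_of_nonneg (by positivity), div_eq_mul_inv]
      simp [hb]
    simp_rw [hint]
    refine summable_of_sum_range_le (c := b 0 ^ (-β) / β) (fun n => ?_) (fun n => ?_)
    · exact div_nonneg (sub_nonneg.2 (hmono n)) (Real.rpow_nonneg (hpos _).le _)
    · calc ∑ i ∈ Finset.range n, (b (i + 1) - b i) / b (i + 1) ^ (1 + β)
          ≤ ∑ i ∈ Finset.range n, (b i ^ (-β) / β - b (i + 1) ^ (-β) / β) :=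
            Finset.sum_le_sum fun i _ => by
              rw [← sub_div]
              exact sub_div_rpow_le (hpos _) (hmono i) hβ
        _ = b 0 ^ (-β) / β - b n ^ (-β) / β := Finset.sum_range_sub' _ n
        _ ≤ b 0 ^ (-β) / β := by
            have : 0 ≤ b n ^ (-β) / β := div_nonneg (Real.rpow_nonneg (hpos _).le _) hβ.le
            linarith

/-- A Haar function `h` is an eigenfunction of `D^β`, with eigenvalue
`μ(Q)^{-β} + ∫_{X \ Q} δ(x, y)^{-1-β} dμ(y)`, `x ∈ Q = Q(h)`. -/
theorem HaarSystem.exists_fracDeriv_eq (hX : IsHomogeneousType d μ) (h𝒟 : IsDyadicFamily d μ 𝒟)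
    (hquad : IsQuadrant 𝒟) (H : HaarSystem μ 𝒟) {β : ℝ} (hβ : 0 < β) (h : H.functions) :
    ∃ c : ℝ, ∀ᵐ x ∂μ, fracDeriv μ 𝒟 β h.1 x = c * h.1 x := by
  have hQ := H.base_mem h
  have hpos := h𝒟.measureReal_pos hX hQ
  have hQm := h𝒟.measurableSet _ _ hQ
  obtain ⟨x₀, hx₀⟩ := h𝒟.nonempty hQ
  refine ⟨μ.real (H.base h) ^ (-β)
    + ∫ y in (H.base h)ᶜ, (dyadicDist μ 𝒟 x₀ y ^ (1 + β))⁻¹ ∂μ, ?_⟩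
  filter_upwards [h𝒟.ae_exists_cubeChain] with x ⟨R, hR⟩
  by_cases hx : x ∈ H.base h
  · have hRQ : H.base h = R (H.scale h) := hR.eq_of_mem h𝒟 hQ hx
    have hoff : R (H.scale h + 1) ∈ offspring 𝒟 (H.scale h) (H.base h) := by
      rw [hRQ]
      exact hR.offspring h𝒟 _
    have hsplit : ∀ y, (h.1 x - h.1 y) / dyadicDist μ 𝒟 x y ^ (1 + β)
        = ((H.base h).indicator (fun _ => h.1 x) y - h.1 y) / μ.real (H.base h) ^ (1 + β)
          + h.1 x * (H.base h)ᶜ.indicator (fun y => (dyadicDist μ 𝒟 x₀ y ^ (1 + β))⁻¹) y := by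
      intro y
      by_cases hy : y ∈ H.base h
      · rw [Set.indicator_of_mem hy, Set.indicator_of_notMem (Set.notMem_compl_iff.2 hy),
          mul_zero, add_zero]
        by_cases hy' : y ∈ R (H.scale h + 1)
        · rw [H.const_on_child h _ hoff x (hR _).2 y hy']
          simp
        · rw [h𝒟.dyadicDist_eq hX hQ hoff (hR _).2 ⟨hy, hy'⟩]
      · rw [Set.indicator_of_notMem hy, Set.indicator_of_mem (show y ∈ (H.base h)ᶜ from hy),
          H.eq_zero_off h y hy, h𝒟.dyadicDist_congr hQ hx hx₀ hy]
        simp [div_eq_mul_inv]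
    have hint1 : Integrable ((H.base h).indicator fun _ => h.1 x) μ :=
      (integrable_indicator_iff hQm).2
        (integrableOn_const (h𝒟.measure_lt_top hX hQ).ne)
    have hint2 := H.integrable hX h𝒟 h
    have hint12 : Integrable (fun y => ((H.base h).indicator (fun _ => h.1 x) y - h.1 y)
        / μ.real (H.base h) ^ (1 + β)) μ := (hint1.sub hint2).div_const _
    have hint3 : Integrable ((H.base h)ᶜ.indicator
        fun y => (dyadicDist μ 𝒟 x₀ y ^ (1 + β))⁻¹) μ := by
      rw [integrable_indicator_iff hQm.compl]
      have := hR.integrableOn_compl hX h𝒟 hquad hβ (H.scale h)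
      rw [← hRQ] at this
      exact this.congr_fun
        (fun y hy => by simp only [h𝒟.dyadicDist_congr hQ hx hx₀ hy]) hQm.compl
    unfold fracDeriv
    rw [integral_congr_ae (Eventually.of_forall hsplit),
      integral_add hint12 (hint3.const_mul _),
      integral_div, integral_sub hint1 hint2, integral_const_mul, integral_indicator hQm,
      integral_indicator hQm.compl, setIntegral_const, H.integral_eq_zero h, smul_eq_mul,
      Real.rpow_add hpos, Real.rpow_one, Real.rpow_neg hpos.le]
    field_simp
    ring
  · have hc : ∀ y, (h.1 x - h.1 y) / dyadicDist μ 𝒟 x y ^ (1 + β)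
        = -(dyadicDist μ 𝒟 x₀ x ^ (1 + β))⁻¹ * h.1 y := by
      intro y
      rw [H.eq_zero_off h x hx]
      by_cases hy : y ∈ H.base h
      · rw [dyadicDist_comm, h𝒟.dyadicDist_congr hQ hy hx₀ hx, div_eq_mul_inv]
        ring
      · simp [H.eq_zero_off h y hy]
    unfold fracDeriv
    rw [integral_congr_ae (Eventually.of_forall hc), integral_const_mul, H.integral_eq_zero h,
      H.eq_zero_off h x hx, mul_zero, mul_zero]

theorem HaarSystem.existsUnique_multiplier (hX : IsHomogeneousType d μ)
    (h𝒟 : IsDyadicFamily d μ 𝒟) (hquad : IsQuadrant 𝒟) (H : HaarSystem μ 𝒟) {β : ℝ} (hβ : 0 < β) :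
    ∃! m : H.functions → ℝ, IsHaarMultiplier H β m := by
  have hpos : ∀ h, 0 < μ.real (H.base h) ^ (-β) := fun h =>
    Real.rpow_pos_of_pos (h𝒟.measureReal_pos hX (H.base_mem h)) _
  choose c hc using fun h => H.exists_fracDeriv_eq hX h𝒟 hquad hβ h
  refine ⟨fun h => c h / μ.real (H.base h) ^ (-β), fun h => ?_, fun m hm => funext fun h => ?_⟩
  · simpa only [div_mul_cancel₀ _ (hpos h).ne'] using hc h
  · rw [eq_div_iff (hpos h).ne']
    by_contra hne
    refine H.not_ae_eq_zero h ?_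
    filter_upwards [hc h, hm h] with x h1 h2
    rw [h1] at h2
    exact (mul_eq_mul_right_iff.1 h2).resolve_left (Ne.symm hne)

/-! ### Haar expansion on a single cube -/

/-- The Haar functions based on the cube `Q` of scale `j`. -/
def HaarSystem.basedOn (H : HaarSystem μ 𝒟) (j : ℤ) (Q : Set X) : Set H.functions :=
  {h | H.scale h = j ∧ H.base h = Q}

theorem IsDyadicFamily.finite_offspring (h𝒟 : IsDyadicFamily d μ 𝒟) (hX : IsHomogeneousType d μ)
    {j : ℤ} {Q : Set X} (hQ : Q ∈ 𝒟 j) : (offspring 𝒟 j Q).Finite := by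
  obtain ⟨N, hN⟩ := h𝒟.exists_encard_offspring_le hX
  exact Set.finite_of_encard_le_coe (hN j Q hQ)

theorem HaarSystem.encard_basedOn_le (H : HaarSystem μ 𝒟) {j : ℤ} {Q : Set X} (hQ : Q ∈ 𝒟 j) :
    (H.basedOn j Q).encard ≤ (offspring 𝒟 j Q).encard :=
  le_self_add.trans_eq (H.card_based j Q hQ)

theorem HaarSystem.finite_basedOn (hX : IsHomogeneousType d μ) (h𝒟 : IsDyadicFamily d μ 𝒟)
    (H : HaarSystem μ 𝒟) {j : ℤ} {Q : Set X} (hQ : Q ∈ 𝒟 j) : (H.basedOn j Q).Finite :=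
  Set.finite_of_encard_le_coe <| (H.encard_basedOn_le hQ).trans_eq
    (h𝒟.finite_offspring hX hQ).encard_eq_coe_toFinset_card

theorem HaarSystem.nontrivial_offspring (H : HaarSystem μ 𝒟) (h : H.functions) :
    (offspring 𝒟 (H.scale h) (H.base h)).Nontrivial := by
  rw [← Set.one_lt_encard_iff_nontrivial, ← H.card_based _ _ (H.base_mem h)]
  have h1 : 1 ≤ (H.basedOn (H.scale h) (H.base h)).encard :=
    Set.one_le_encard_iff_nonempty.2 ⟨h, rfl, rfl⟩
  calc (1 : ℕ∞) < 1 + 1 := by norm_num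
    _ ≤ _ := by gcongr; exact h1

theorem HaarSystem.countable (hX : IsHomogeneousType d μ) (h𝒟 : IsDyadicFamily d μ 𝒟)
    (H : HaarSystem μ 𝒟) : Countable H.functions := by
  refine Set.countable_univ_iff.1 (Set.Countable.mono (fun h _ => ?_)
    (Set.countable_iUnion fun j => (h𝒟.countable hX j).biUnion
      fun Q hQ => (H.finite_basedOn hX h𝒟 hQ).countable))
  exact Set.mem_iUnion.2 ⟨H.scale h, Set.mem_iUnion₂.2 ⟨H.base h, H.base_mem h, rfl, rfl⟩⟩

theorem IsDyadicFamily.integral_eq_sum_offspring {E : Type*} [NormedAddCommGroup E]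
    [NormedSpace ℝ E] (h𝒟 : IsDyadicFamily d μ 𝒟) {j : ℤ} {Q : Set X} (hQ : Q ∈ 𝒟 j)
    [Fintype (offspring 𝒟 j Q)] {f : X → E} (hf : IntegrableOn f Q μ) :
    ∫ x in Q, f x ∂μ = ∑ Q' : offspring 𝒟 j Q, ∫ x in (Q' : Set X), f x ∂μ := by
  rw [← integral_iUnion_fintype (s := fun Q' : offspring 𝒟 j Q => (Q' : Set X))
    (fun Q' => h𝒟.measurableSet _ _ Q'.2.1)
    (fun Q' R hne => h𝒟.disjoint_offspring Q'.2 R.2 (Subtype.coe_injective.ne hne))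
    (fun Q' => hf.mono_set Q'.2.2)]
  refine setIntegral_congr_set ?_
  filter_upwards [h𝒟.ae_exists_offspring hQ] with x hx
  refine propext ⟨fun h => ?_, fun h => ?_⟩
  · obtain ⟨Q', hQ', hxQ'⟩ := hx h
    exact Set.mem_iUnion.2 ⟨⟨Q', hQ'⟩, hxQ'⟩
  · obtain ⟨Q', hxQ'⟩ := Set.mem_iUnion.1 h
    exact Q'.2.2 hxQ'

/-- The integral of `u` against a function which is constant on the children of `Q` and vanishes
off `Q`. -/
theorem IsDyadicFamily.integral_mul_eq_sum_offspring {𝕜 : Type*} [RCLike 𝕜]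
    (h𝒟 : IsDyadicFamily d μ 𝒟) {j : ℤ} {Q : Set X} (hQ : Q ∈ 𝒟 j)
    [Fintype (offspring 𝒟 j Q)] {u f : X → 𝕜} (hint : Integrable (fun x => u x * f x) μ)
    (h0 : ∀ x, x ∉ Q → f x = 0) (p : offspring 𝒟 j Q → X)
    (hf : ∀ Q' : offspring 𝒟 j Q, ∀ x ∈ (Q' : Set X), f x = f (p Q')) :
    ∫ x, u x * f x ∂μ
      = ∑ Q' : offspring 𝒟 j Q, (∫ x in (Q' : Set X), u x ∂μ) * f (p Q') := by
  rw [← setIntegral_eq_integral_of_forall_compl_eq_zero (s := Q)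
    (fun x hx => by rw [h0 x hx, mul_zero]), h𝒟.integral_eq_sum_offspring hQ hint.integrableOn]
  refine Finset.sum_congr rfl fun Q' _ => ?_
  rw [← integral_mul_const]
  exact setIntegral_congr_fun (h𝒟.measurableSet _ _ Q'.2.1) fun x hx => by simp only [hf Q' x hx]

/-- Completeness of the Haar functions based on `Q` in the space of functions which are constant
on the children of `Q` and have integral zero, in the form of a reproducing kernel. The values of
the Haar functions and of the constant, suitably weighted, form a square matrix with orthonormal
rows, hence one with orthonormal columns. -/
theorem HaarSystem.sum_mul_eq (hX : IsHomogeneousType d μ) (h𝒟 : IsDyadicFamily d μ 𝒟)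
    (H : HaarSystem μ 𝒟) {j : ℤ} {Q : Set X} (hQ : Q ∈ 𝒟 j) [DecidableEq (Set X)]
    {Q' Q'' : Set X} (hQ' : Q' ∈ offspring 𝒟 j Q) (hQ'' : Q'' ∈ offspring 𝒟 j Q) {x y : X}
    (hx : x ∈ Q') (hy : y ∈ Q'') :
    ∑ h ∈ (H.finite_basedOn hX h𝒟 hQ).toFinset, h.1 x * h.1 y
      = (if Q' = Q'' then (μ.real Q')⁻¹ else 0) - (μ.real Q)⁻¹ := by
  classical
  have := (h𝒟.finite_offspring hX hQ).fintype
  have := (H.finite_basedOn hX h𝒟 hQ).fintype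
  have hpQ := h𝒟.measureReal_pos hX hQ
  have hp : ∀ R : offspring 𝒟 j Q, 0 < μ.real (R : Set X) :=
    fun R => h𝒟.measureReal_pos hX R.2.1
  choose p hp_mem using fun R : offspring 𝒟 j Q => h𝒟.nonempty R.2.1
  have hoff : ∀ (h : H.basedOn j Q) x, x ∉ Q → h.1.1 x = 0 := fun h x hx =>
    H.eq_zero_off h.1 x (by rw [h.2.2]; exact hx)
  have hconst : ∀ (h : H.basedOn j Q) (R : offspring 𝒟 j Q), ∀ x ∈ (R : Set X),
      h.1.1 x = h.1.1 (p R) := fun h R x hx =>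
    H.const_on_child h.1 R (by rw [h.2.1, h.2.2]; exact R.2) x hx _ (hp_mem R)
  have hconst1 : ∀ R : offspring 𝒟 j Q, ∫ x in (R : Set X), (1 : ℝ) ∂μ = μ.real (R : Set X) := by
    intro R
    simp
  -- `M` is the matrix of values, with the normalized constant as row `none`.
  let M : Matrix (Option (H.basedOn j Q)) (offspring 𝒟 j Q) ℝ :=
    Matrix.of fun o R => √(μ.real (R : Set X)) * o.elim (√(μ.real Q))⁻¹ fun h => h.1.1 (p R)
  have hM0 : ∀ R, M none R = √(μ.real (R : Set X)) * (√(μ.real Q))⁻¹ := fun _ => rfl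
  have hM1 : ∀ h R, M (some h) R = √(μ.real (R : Set X)) * h.1.1 (p R) := fun _ _ => rfl
  have hsq : ∀ (R : offspring 𝒟 j Q) (a b : ℝ), √(μ.real (R : Set X)) * a *
      (√(μ.real (R : Set X)) * b) = μ.real (R : Set X) * (a * b) := by
    intro R a b
    rw [mul_mul_mul_comm, Real.mul_self_sqrt (hp R).le]
  have hsum1 : ∑ R : offspring 𝒟 j Q, μ.real (R : Set X) = μ.real Q := by
    have := h𝒟.integral_eq_sum_offspring hQ (f := fun _ => (1 : ℝ))
      (integrableOn_const (h𝒟.measure_lt_top hX hQ).ne)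
    simpa [hconst1] using this.symm
  have hsum2 : ∀ h : H.basedOn j Q,
      ∑ R : offspring 𝒟 j Q, μ.real (R : Set X) * h.1.1 (p R) = 0 := by
    intro h
    have := h𝒟.integral_mul_eq_sum_offspring hQ (u := fun _ => (1 : ℝ)) (f := h.1.1)
      (by simpa using H.integrable hX h𝒟 h.1) (hoff h) p (hconst h)
    simpa [hconst1, H.integral_eq_zero] using this.symm
  have hsum3 : ∀ h h' : H.basedOn j Q,
      ∑ R : offspring 𝒟 j Q, μ.real (R : Set X) * (h.1.1 (p R) * h'.1.1 (p R))
        = if h = h' then 1 else 0 := by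
    intro h h'
    have := h𝒟.integral_mul_eq_sum_offspring hQ (u := fun _ => (1 : ℝ))
      (f := fun x => h.1.1 x * h'.1.1 x)
      (by simp only [one_mul]; exact (H.memLp h.1).integrable_mul (H.memLp h'.1))
      (fun x hx => by rw [hoff h x hx, zero_mul]) p
      (fun R x hx => by rw [hconst h R x hx, hconst h' R x hx])
    simp only [hconst1, one_mul] at this
    rw [← this]
    split_ifs with heq
    · subst heq
      simpa [pow_two] using H.normalized h.1
    · exact H.orthogonal _ _ (Subtype.coe_injective.ne heq)
  have hM : M * M.transpose = 1 := by
    ext o o'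
    rw [Matrix.mul_apply]
    rcases o with _ | h <;> rcases o' with _ | h' <;>
      simp only [Matrix.transpose_apply, hM0, hM1, hsq]
    · rw [← Finset.sum_mul, hsum1, ← mul_inv, Real.mul_self_sqrt hpQ.le, mul_inv_cancel₀ hpQ.ne',
        Matrix.one_apply_eq]
    · simp_rw [mul_left_comm _ (√(μ.real Q))⁻¹]
      rw [← Finset.mul_sum, hsum2, mul_zero, Matrix.one_apply_ne (by simp)]
    · simp_rw [← mul_assoc]
      rw [← Finset.sum_mul, hsum2, zero_mul, Matrix.one_apply_ne (by simp)]
    · rw [hsum3, Matrix.one_apply]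
      simp
  have hcard : Fintype.card (Option (H.basedOn j Q)) = Fintype.card (offspring 𝒟 j Q) := by
    have h1 := H.card_based j Q hQ
    change (H.basedOn j Q).encard + 1 = _ at h1
    rw [← Set.coe_fintypeCard, ← Set.coe_fintypeCard] at h1
    rw [Fintype.card_option]
    exact_mod_cast h1
  have hM' := (Matrix.mul_eq_one_comm_of_card_eq _ _ _ hcard).1 hM
  have hentry := congrFun (congrFun hM' ⟨Q', hQ'⟩) ⟨Q'', hQ''⟩
  rw [Matrix.mul_apply, Fintype.sum_option] at hentry
  simp only [Matrix.transpose_apply, hM0, hM1] at hentry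
  have hs' : 0 < √(μ.real Q') := Real.sqrt_pos.2 (hp ⟨Q', hQ'⟩)
  have hs'' : 0 < √(μ.real Q'') := Real.sqrt_pos.2 (hp ⟨Q'', hQ''⟩)
  have hS : ∑ h ∈ (H.finite_basedOn hX h𝒟 hQ).toFinset, h.1 x * h.1 y
      = ∑ h : H.basedOn j Q, h.1.1 (p ⟨Q', hQ'⟩) * h.1.1 (p ⟨Q'', hQ''⟩) := by
    rw [← Finset.sum_subtype (p := fun h => h ∈ H.basedOn j Q)
      (H.finite_basedOn hX h𝒟 hQ).toFinset (fun _ => Set.Finite.mem_toFinset _)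
      (fun h : H.functions => h.1 (p ⟨Q', hQ'⟩) * h.1 (p ⟨Q'', hQ''⟩))]
    refine Finset.sum_congr rfl fun h hh => ?_
    have hh' : h ∈ H.basedOn j Q := by simpa using hh
    rw [hconst ⟨h, hh'⟩ ⟨Q', hQ'⟩ x hx, hconst ⟨h, hh'⟩ ⟨Q'', hQ''⟩ y hy]
  simp_rw [mul_mul_mul_comm _ _ (√(μ.real Q'')) _] at hentry
  rw [← Finset.mul_sum, ← hS, ← mul_inv, Real.mul_self_sqrt hpQ.le, ← mul_add] at hentry
  by_cases heq : Q' = Q''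
  · subst heq
    rw [Real.mul_self_sqrt (hp ⟨Q', hQ'⟩).le, Matrix.one_apply_eq] at hentry
    rw [if_pos rfl, eq_sub_iff_add_eq', eq_inv_of_mul_eq_one_right hentry]
  · rw [Matrix.one_apply_ne (by simpa using heq)] at hentry
    rw [if_neg heq, zero_sub]
    have := (mul_eq_zero.1 hentry).resolve_left (mul_pos hs' hs'').ne'
    linarith

/-- The part of the Haar series of `u` at the scale `j` is, at a point of a child `Q'` of the cube
`Q` of this scale, the difference of the averages of `u` over `Q'` and `Q`. -/
theorem HaarSystem.hasSum_scale (hX : IsHomogeneousType d μ) (h𝒟 : IsDyadicFamily d μ 𝒟)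
    (H : HaarSystem μ 𝒟) {u : X → ℂ} (hu : MemLp u 2 μ) {j : ℤ} {Q Q' : Set X} (hQ : Q ∈ 𝒟 j)
    (hQ' : Q' ∈ offspring 𝒟 j Q) {x : X} (hx : x ∈ Q') :
    HasSum (fun h : {h : H.functions // H.scale h = j} =>
      (∫ y, u y * (h.1.1 y : ℂ) ∂μ) * (h.1.1 x : ℂ))
      ((⨍ y in Q', u y ∂μ) - ⨍ y in Q, u y ∂μ) := by
  classical
  have := (h𝒟.finite_offspring hX hQ).fintype
  choose p hp_mem using fun R : offspring 𝒟 j Q => h𝒟.nonempty R.2.1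
  have hfinB := H.finite_basedOn hX h𝒟 hQ
  have huint : IntegrableOn u Q μ := by
    have : IsFiniteMeasure (μ.restrict Q) := ⟨by simpa using h𝒟.measure_lt_top hX hQ⟩
    exact (hu.restrict Q).integrable one_le_two
  have hcoef : ∀ h ∈ hfinB.toFinset, ∫ y, u y * (h.1 y : ℂ) ∂μ
      = ∑ R : offspring 𝒟 j Q, (∫ y in (R : Set X), u y ∂μ) * (h.1 (p R) : ℂ) := by
    intro h hh
    have hh' : h ∈ H.basedOn j Q := by simpa using hh
    refine h𝒟.integral_mul_eq_sum_offspring hQ (f := fun y => (h.1 y : ℂ))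
      (hu.integrable_mul (H.memLp h).ofReal) (fun y hy => ?_) p (fun R y hy => ?_)
    · rw [H.eq_zero_off h y (by rw [hh'.2]; exact hy), Complex.ofReal_zero]
    · rw [H.const_on_child h R (by rw [hh'.1, hh'.2]; exact R.2) y hy _ (hp_mem R)]
  have hsum : ∑ h ∈ hfinB.toFinset, (∫ y, u y * (h.1 y : ℂ) ∂μ) * (h.1 x : ℂ)
      = (⨍ y in Q', u y ∂μ) - ⨍ y in Q, u y ∂μ := by
    calc _ = ∑ h ∈ hfinB.toFinset, ∑ R : offspring 𝒟 j Q,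
          (∫ y in (R : Set X), u y ∂μ) * ((h.1 x * h.1 (p R) : ℝ) : ℂ) := by
          refine Finset.sum_congr rfl fun h hh => ?_
          rw [hcoef h hh, Finset.sum_mul]
          refine Finset.sum_congr rfl fun R _ => ?_
          push_cast
          ring
      _ = ∑ R : offspring 𝒟 j Q, (∫ y in (R : Set X), u y ∂μ) *
          (((if Q' = R then (μ.real Q')⁻¹ else 0) - (μ.real Q)⁻¹ : ℝ) : ℂ) := by
          rw [Finset.sum_comm]
          refine Finset.sum_congr rfl fun R _ => ?_
          rw [← Finset.mul_sum, ← Complex.ofReal_sum, H.sum_mul_eq hX h𝒟 hQ hQ' R.2 hx (hp_mem R)]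
      _ = _ := by
          simp_rw [Complex.ofReal_sub, mul_sub, Finset.sum_sub_distrib, ← Finset.sum_mul]
          rw [← h𝒟.integral_eq_sum_offspring hQ huint,
            Finset.sum_eq_single (⟨Q', hQ'⟩ : offspring 𝒟 j Q)
            (fun R _ hne => by
              rw [if_neg (fun h => hne (Subtype.ext h.symm)), Complex.ofReal_zero, mul_zero])
            (fun h => absurd (Finset.mem_univ _) h)]
          rw [if_pos rfl, setAverage_eq, setAverage_eq, Complex.real_smul, Complex.real_smul]
          ring
  have hss : HasSum ({h : H.functions | H.scale h = j}.indicator fun h =>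
      (∫ y, u y * (h.1 y : ℂ) ∂μ) * (h.1 x : ℂ)) ((⨍ y in Q', u y ∂μ) - ⨍ y in Q, u y ∂μ) := by
    have hind : ∀ h ∈ hfinB.toFinset, ({h : H.functions | H.scale h = j}.indicator fun h =>
        (∫ y, u y * (h.1 y : ℂ) ∂μ) * (h.1 x : ℂ)) h
          = (∫ y, u y * (h.1 y : ℂ) ∂μ) * (h.1 x : ℂ) := fun h hh =>
      Set.indicator_of_mem
        (show h ∈ {h : H.functions | H.scale h = j} from (hfinB.mem_toFinset.1 hh).1) _
    rw [← hsum, ← Finset.sum_congr rfl hind]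
    refine hasSum_sum_of_ne_finset_zero fun h hh => ?_
    by_cases hs : H.scale h = j
    · rw [Set.indicator_of_mem (by exact hs)]
      have hxb : x ∉ H.base h := fun hxb => hh <| by
        have : h ∈ H.basedOn j Q :=
          ⟨hs, h𝒟.eq_of_mem (hs ▸ H.base_mem h) hQ hxb (hQ'.2 hx)⟩
        simpa using this
      rw [H.eq_zero_off h x hxb, Complex.ofReal_zero, mul_zero]
    · exact Set.indicator_of_notMem (by exact hs) _
  exact hasSum_subtype_iff_indicator.2 hss

/-! ### Haar coefficients of a Besov function -/

/-- The integrand of the Besov seminorm. -/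
noncomputable def besovDensity (μ : Measure X) (𝒟 : ℤ → Set (Set X)) (σ : ℝ) (u : X → ℂ)
    (p : X × X) : ENNReal :=
  ENNReal.ofReal (‖u p.1 - u p.2‖ ^ 2 / dyadicDist μ 𝒟 p.1 p.2 ^ (1 + 2 * σ))

theorem IsDyadicFamily.measurable_besovDensity (h𝒟 : IsDyadicFamily d μ 𝒟)
    (hX : IsHomogeneousType d μ) (σ : ℝ) {u : X → ℂ} (hu : Measurable u) :
    Measurable (besovDensity μ 𝒟 σ u) := by
  have h : besovDensity μ 𝒟 σ u = fun p : X × X => ENNReal.ofReal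
      (‖u p.1 - u p.2‖ ^ 2 / (infCubeMeasure μ 𝒟 p.1 p.2).toReal ^ (1 + 2 * σ)) := by
    funext p
    by_cases hp : p.1 = p.2
    · simp [besovDensity, hp]
    · rw [besovDensity, h𝒟.dyadicDist_eq_toReal hX hp]
  rw [h]
  have hm := h𝒟.measurable_infCubeMeasure hX
  have hu' : Measurable fun p : X × X => u p.1 - u p.2 :=
    (hu.comp measurable_fst).sub (hu.comp measurable_snd)
  exact ((hu'.norm.pow_const 2).div (hm.ennreal_toReal.pow_const _)).ennreal_ofReal

theorem enorm_complex_ofReal (r : ℝ) : ‖(r : ℂ)‖ₑ = ‖r‖ₑ := by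
  rw [← ofReal_norm, ← ofReal_norm, Complex.norm_real]

theorem integral_prod_sub_mul_sub {𝕜 : Type*} [RCLike 𝕜] {ν : Measure X} [IsFiniteMeasure ν]
    {f g : X → 𝕜} (hf : MemLp f 2 ν) (hg : MemLp g 2 ν) :
    Integrable (fun p : X × X => (f p.1 - f p.2) * (g p.1 - g p.2)) (ν.prod ν) ∧
    ∫ p : X × X, (f p.1 - f p.2) * (g p.1 - g p.2) ∂ν.prod ν
      = 2 * (ν.real Set.univ * ∫ x, f x * g x ∂ν - (∫ x, f x ∂ν) * ∫ x, g x ∂ν) := by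
  have hfi := hf.integrable one_le_two
  have hgi := hg.integrable one_le_two
  have hfg : Integrable (fun x => f x * g x) ν := hf.integrable_mul hg
  have h1 : Integrable (fun _ : X => (1 : 𝕜)) ν := integrable_const 1
  have i1 := hfg.mul_prod h1
  have i2 := h1.mul_prod hfg
  have i3 := hfi.mul_prod hgi
  have i4 := hgi.mul_prod hfi
  have e : (fun p : X × X => (f p.1 - f p.2) * (g p.1 - g p.2)) = fun p =>
      (f p.1 * g p.1 * 1 + 1 * (f p.2 * g p.2)) - (f p.1 * g p.2 + g p.1 * f p.2) := by
    funext p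
    ring
  rw [e]
  refine ⟨(i1.add i2).sub (i3.add i4), ?_⟩
  have i12 : Integrable (fun p : X × X => f p.1 * g p.1 * 1 + 1 * (f p.2 * g p.2)) (ν.prod ν) :=
    i1.add i2
  have i34 : Integrable (fun p : X × X => f p.1 * g p.2 + g p.1 * f p.2) (ν.prod ν) := i3.add i4
  rw [integral_sub i12 i34, integral_add i1 i2, integral_add i3 i4,
    integral_prod_mul (fun x => f x * g x) (fun _ => (1 : 𝕜)),
    integral_prod_mul (fun _ => (1 : 𝕜)) (fun x => f x * g x), integral_prod_mul,
    integral_prod_mul]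
  have hone : ∫ _ : X, (1 : 𝕜) ∂ν = (ν.real Set.univ : 𝕜) := by
    rw [integral_const, RCLike.real_smul_eq_coe_mul, mul_one]
  rw [hone]
  ring

/-- The pairs of points of `Q(h)` at which `h` takes different values. -/
def HaarSystem.jumpSet (H : HaarSystem μ 𝒟) (h : H.functions) : Set (X × X) :=
  {p | p.1 ∈ H.base h ∧ p.2 ∈ H.base h ∧ h.1 p.1 ≠ h.1 p.2}

theorem HaarSystem.measurableSet_jumpSet (h𝒟 : IsDyadicFamily d μ 𝒟) (H : HaarSystem μ 𝒟)
    (h : H.functions) : MeasurableSet (H.jumpSet h) := by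
  have hQ := h𝒟.measurableSet _ _ (H.base_mem h)
  have hm := H.measurable h
  exact (measurable_fst hQ).inter ((measurable_snd hQ).inter
    (measurableSet_eq_fun (hm.comp measurable_fst) (hm.comp measurable_snd)).compl)

theorem HaarSystem.integral_mul_eq_setIntegral (H : HaarSystem μ 𝒟) (h : H.functions)
    (u : X → ℂ) :
    ∫ x, u x * (h.1 x : ℂ) ∂μ = ∫ x in H.base h, u x * (h.1 x : ℂ) ∂μ :=
  (setIntegral_eq_integral_of_forall_compl_eq_zero fun x hx => by
    rw [H.eq_zero_off h x hx, Complex.ofReal_zero, mul_zero]).symm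

/-- A Haar coefficient is controlled by the increments of `u` between different children of the
cube: `μ(Q) ⟨u, h⟩` is half the double integral over `Q × Q` of
`(u(x) - u(y)) (h(x) - h(y))`. -/
theorem HaarSystem.enorm_coeff_sq_le (hX : IsHomogeneousType d μ) (h𝒟 : IsDyadicFamily d μ 𝒟)
    (H : HaarSystem μ 𝒟) (h : H.functions) {u : X → ℂ} (hum : Measurable u) (hu : MemLp u 2 μ) :
    ‖∫ x, u x * (h.1 x : ℂ) ∂μ‖ₑ ^ 2 * μ (H.base h)
      ≤ ∫⁻ p in H.jumpSet h, ‖u p.1 - u p.2‖ₑ ^ 2 ∂μ.prod μ := by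
  have := hX.sigmaFinite
  set Q := H.base h with hQdef
  have hQ := H.base_mem h
  have hQtop := h𝒟.measure_lt_top hX hQ
  have hQpos := h𝒟.measure_pos hX hQ
  have hrpos := h𝒟.measureReal_pos hX hQ
  have hQm := h𝒟.measurableSet _ _ hQ
  set ν := μ.restrict Q with hν
  have hfin : IsFiniteMeasure ν := ⟨by simpa [hν] using hQtop⟩
  have hνuniv : ν.real Set.univ = μ.real Q := by simp [hν]
  set a := ∫ x, u x * (h.1 x : ℂ) ∂μ with ha
  have hint0 : ∫ x, h.1 x ∂ν = 0 := by
    rw [hν, setIntegral_eq_integral_of_forall_compl_eq_zero (H.eq_zero_off h), H.integral_eq_zero]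
  have hint2 : ∫ x, h.1 x * h.1 x ∂ν = 1 := by
    rw [hν, setIntegral_eq_integral_of_forall_compl_eq_zero
      (fun x hx => by rw [H.eq_zero_off h x hx, mul_zero])]
    simpa [pow_two] using H.normalized h
  have hhν := (H.memLp h).restrict Q
  have hhC : MemLp (fun x => (h.1 x : ℂ)) 2 ν := hhν.ofReal
  obtain ⟨-, hA⟩ := integral_prod_sub_mul_sub (𝕜 := ℂ) (hu.restrict Q) hhC
  obtain ⟨hBi, hB⟩ := integral_prod_sub_mul_sub (𝕜 := ℝ) hhν hhν
  rw [← hν] at hA hBi hB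
  rw [hint0, hint2, hνuniv] at hB
  have hint0' : ∫ x, (h.1 x : ℂ) ∂ν = 0 := by
    rw [integral_complex_ofReal, hint0, Complex.ofReal_zero]
  have haν : ∫ x, u x * (h.1 x : ℂ) ∂ν = a := (H.integral_mul_eq_setIntegral h u).symm
  rw [hint0', haν, hνuniv, mul_zero, sub_zero] at hA
  have hAnorm : ‖2 * ((RCLike.ofReal (μ.real Q) : ℂ) * a)‖ₑ = 2 * (μ Q * ‖a‖ₑ) := by
    rw [enorm_mul, enorm_mul, ← ofReal_norm (RCLike.ofReal (μ.real Q) : ℂ),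
      RCLike.norm_ofReal, abs_of_pos hrpos, ofReal_measureReal hQtop.ne]
    congr 1
    rw [← ofReal_norm]
    simp
  have hBl : ∫⁻ p : X × X, ‖h.1 p.1 - h.1 p.2‖ₑ ^ (2 : ℝ) ∂ν.prod ν = 2 * μ Q := by
    have e : ∀ p : X × X, ‖h.1 p.1 - h.1 p.2‖ₑ ^ (2 : ℝ)
        = ENNReal.ofReal ((h.1 p.1 - h.1 p.2) * (h.1 p.1 - h.1 p.2)) := by
      intro p
      rw [ENNReal.rpow_two, ← ofReal_norm, ← ENNReal.ofReal_pow (norm_nonneg _),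
        Real.norm_eq_abs, sq_abs, pow_two]
    simp_rw [e]
    rw [← ofReal_integral_eq_lintegral_ofReal hBi
      (Eventually.of_forall fun p => mul_self_nonneg _), hB]
    simp only [RCLike.ofReal_real_eq_id, id, mul_one, mul_zero, sub_zero]
    rw [ENNReal.ofReal_mul zero_le_two, ofReal_measureReal hQtop.ne, ENNReal.ofReal_ofNat]
  set T := ∫⁻ p in H.jumpSet h, ‖u p.1 - u p.2‖ₑ ^ 2 ∂μ.prod μ with hT
  have hJm := H.measurableSet_jumpSet h𝒟 h
  have hum' : Measurable fun p : X × X => ‖u p.1 - u p.2‖ₑ :=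
    ((hum.comp measurable_fst).sub (hum.comp measurable_snd)).enorm
  have hhm' : Measurable fun p : X × X => ‖h.1 p.1 - h.1 p.2‖ₑ :=
    (((H.measurable h).comp measurable_fst).sub ((H.measurable h).comp measurable_snd)).enorm
  have hCS := ENNReal.lintegral_mul_le_Lp_mul_Lq (ν.prod ν) Real.HolderConjugate.two_two
    (hum'.indicator hJm).aemeasurable hhm'.aemeasurable
  have hTle : ∫⁻ p, (H.jumpSet h).indicator (fun p => ‖u p.1 - u p.2‖ₑ) p ^ (2 : ℝ) ∂ν.prod ν
      ≤ T := by
    rw [hν, Measure.prod_restrict, hT, ← lintegral_indicator hJm]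
    refine (setLIntegral_le_lintegral _ _).trans (lintegral_mono fun p => ?_)
    by_cases hp : p ∈ H.jumpSet h <;> simp [hp]
  have hle : 2 * (μ Q * ‖a‖ₑ) ≤ T ^ (1 / 2 : ℝ) * (2 * μ Q) ^ (1 / 2 : ℝ) := by
    rw [← hAnorm, ← hA, ← hBl]
    refine (enorm_integral_le_lintegral_enorm _).trans (le_trans (le_of_eq ?_) (hCS.trans ?_))
    · have hae : ∀ᵐ p ∂ν.prod ν, p ∈ Q ×ˢ Q := by
        rw [hν, Measure.prod_restrict]
        exact ae_restrict_mem (hQm.prod hQm)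
      refine lintegral_congr_ae (hae.mono fun p hpQ => ?_)
      simp only [Pi.mul_apply]
      by_cases hp : p ∈ H.jumpSet h
      · rw [Set.indicator_of_mem hp, enorm_mul, ← Complex.ofReal_sub, enorm_complex_ofReal]
      · have heq : h.1 p.1 = h.1 p.2 := by
          by_contra hne
          exact hp ⟨hpQ.1, hpQ.2, hne⟩
        simp [heq]
    · gcongr
  have hsq : ∀ s : ENNReal, (s ^ (1 / 2 : ℝ)) ^ 2 = s := fun s => by
    rw [← ENNReal.rpow_two, ← ENNReal.rpow_mul]
    norm_num
  have hle2 := pow_le_pow_left' hle 2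
  rw [mul_pow, mul_pow, mul_pow, hsq, hsq] at hle2
  have hm0 : 2 * μ Q ≠ 0 := mul_ne_zero two_ne_zero hQpos.ne'
  have hmt : 2 * μ Q ≠ ⊤ := ENNReal.mul_ne_top (by simp) hQtop.ne
  have hle3 : 2 * μ Q * (‖a‖ₑ ^ 2 * μ Q * 2) ≤ 2 * μ Q * T :=
    le_trans (le_of_eq (by ring)) (hle2.trans (le_of_eq (by ring)))
  refine le_trans ?_ ((ENNReal.mul_le_mul_iff_right hm0 hmt).1 hle3)
  exact le_mul_of_one_le_right zero_le one_le_two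

/-- At almost every pair of points where a Haar function jumps, the dyadic distance is the measure
of its base. -/
theorem HaarSystem.dyadicDist_of_mem_jumpSet (hX : IsHomogeneousType d μ)
    (h𝒟 : IsDyadicFamily d μ 𝒟) (H : HaarSystem μ 𝒟) {h : H.functions} {p : X × X}
    (hp : p ∈ H.jumpSet h) {R : ℤ → Set X} (hR : IsCubeChain 𝒟 p.1 R) :
    H.base h = R (H.scale h) ∧ p.2 ∈ R (H.scale h) \ R (H.scale h + 1) ∧
      dyadicDist μ 𝒟 p.1 p.2 = μ.real (H.base h) := by
  have hbase : H.base h = R (H.scale h) := hR.eq_of_mem h𝒟 (H.base_mem h) hp.1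
  have hoff := hR.offspring h𝒟 (H.scale h)
  have hnot : p.2 ∉ R (H.scale h + 1) := fun hmem =>
    hp.2.2 (H.const_on_child h _ (by rw [hbase]; exact hoff) _ (hR _).2 _ hmem)
  have hmem : p.2 ∈ R (H.scale h) := hbase ▸ hp.2.1
  refine ⟨hbase, ⟨hmem, hnot⟩, ?_⟩
  rw [hbase]
  exact h𝒟.dyadicDist_eq hX (hR _).1 hoff (hR _).2 ⟨hmem, hnot⟩

/-- The coefficient estimate, in terms of the Besov density. -/
theorem HaarSystem.enorm_coeff_sq_mul_rpow_le (hX : IsHomogeneousType d μ)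
    (h𝒟 : IsDyadicFamily d μ 𝒟) (H : HaarSystem μ 𝒟) (h : H.functions) {u : X → ℂ}
    (hum : Measurable u) (hu : MemLp u 2 μ) (σ : ℝ) :
    ‖∫ x, u x * (h.1 x : ℂ) ∂μ‖ₑ ^ 2 * ENNReal.ofReal (μ.real (H.base h) ^ (-(2 * σ)))
      ≤ ∫⁻ p in H.jumpSet h, besovDensity μ 𝒟 σ u p ∂μ.prod μ := by
  have := hX.sigmaFinite
  have hpos := h𝒟.measureReal_pos hX (H.base_mem h)
  have hfac : ENNReal.ofReal (μ.real (H.base h) ^ (-(2 * σ)))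
      = μ (H.base h) * ENNReal.ofReal (μ.real (H.base h) ^ (1 + 2 * σ))⁻¹ := by
    rw [← ofReal_measureReal (h𝒟.measure_lt_top hX (H.base_mem h)).ne,
      ← ENNReal.ofReal_mul hpos.le, Real.rpow_add hpos, Real.rpow_one, Real.rpow_neg hpos.le,
      mul_inv, mul_inv_cancel_left₀ hpos.ne']
  rw [hfac, ← mul_assoc]
  refine (mul_le_mul_left (H.enorm_coeff_sq_le hX h𝒟 h hum hu) _).trans ?_
  rw [← lintegral_mul_const' _ _ ENNReal.ofReal_ne_top]
  refine lintegral_mono_ae ?_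
  have hgen : ∀ᵐ p : X × X ∂μ.prod μ, ∃ R, IsCubeChain 𝒟 p.1 R :=
    Measure.quasiMeasurePreserving_fst.ae h𝒟.ae_exists_cubeChain
  filter_upwards [ae_restrict_of_ae hgen, ae_restrict_mem (H.measurableSet_jumpSet h𝒟 h)]
    with p ⟨R, hR⟩ hp
  rw [besovDensity, (H.dyadicDist_of_mem_jumpSet hX h𝒟 hp hR).2.2, div_eq_mul_inv,
    ENNReal.ofReal_mul (by positivity), ENNReal.ofReal_pow (norm_nonneg _), ofReal_norm]

/-- The jump sets overlap at most as often as there are Haar functions on one cube. -/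
theorem HaarSystem.tsum_indicator_jumpSet_le (hX : IsHomogeneousType d μ)
    (h𝒟 : IsDyadicFamily d μ 𝒟) (H : HaarSystem μ 𝒟) {N : ℕ}
    (hN : ∀ j, ∀ Q ∈ 𝒟 j, (offspring 𝒟 j Q).encard ≤ N) {p : X × X} {R : ℤ → Set X}
    (hR : IsCubeChain 𝒟 p.1 R) (c : X × X → ENNReal) :
    ∑' h : H.functions, (H.jumpSet h).indicator c p ≤ N * c p := by
  have hsub : ∃ j, {h : H.functions | p ∈ H.jumpSet h} ⊆ H.basedOn j (R j) := by
    by_cases hne : ∃ h : H.functions, p ∈ H.jumpSet h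
    · obtain ⟨h₀, h₀p⟩ := hne
      refine ⟨H.scale h₀, fun h hp => ?_⟩
      obtain ⟨-, m0, -⟩ := H.dyadicDist_of_mem_jumpSet hX h𝒟 h₀p hR
      obtain ⟨hb, m, -⟩ := H.dyadicDist_of_mem_jumpSet hX h𝒟 hp hR
      have hs : H.scale h = H.scale h₀ := by
        rcases lt_trichotomy (H.scale h) (H.scale h₀) with hlt | heq | hlt
        · exact absurd (hR.antitone h𝒟 (by lia : H.scale h + 1 ≤ H.scale h₀) m0.1) m.2
        · exact heq
        · exact absurd (hR.antitone h𝒟 (by lia : H.scale h₀ + 1 ≤ H.scale h) m.1) m0.2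
      exact ⟨hs, by rw [hb, hs]⟩
    · exact ⟨0, fun h hp => absurd ⟨h, hp⟩ hne⟩
  obtain ⟨j, hj⟩ := hsub
  have e : ∀ h : H.functions, (H.jumpSet h).indicator c p
      = {h : H.functions | p ∈ H.jumpSet h}.indicator (fun _ => c p) h := fun h => by
    by_cases hp : p ∈ H.jumpSet h
    · rw [Set.indicator_of_mem hp, Set.indicator_of_mem (by exact hp)]
    · rw [Set.indicator_of_notMem hp, Set.indicator_of_notMem (by exact hp)]
  simp_rw [e]
  rw [← tsum_subtype, ENNReal.tsum_set_const]
  gcongr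
  have := (Set.encard_le_encard hj).trans
    ((H.encard_basedOn_le (hR j).1).trans (hN j _ (hR j).1))
  exact_mod_cast ENat.toENNReal_le.2 this

/-- The Haar coefficients of a Besov function are square summable with the weights
`μ(Q(h))^{-2σ}`. -/
theorem HaarSystem.tsum_coeff_lt_top (hX : IsHomogeneousType d μ) (h𝒟 : IsDyadicFamily d μ 𝒟)
    (H : HaarSystem μ 𝒟) {u : X → ℂ} (hum : Measurable u) (hu : MemLp u 2 μ) {σ : ℝ}
    (hB : ∫⁻ p, besovDensity μ 𝒟 σ u p ∂μ.prod μ < ⊤) :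
    ∑' h : H.functions, ‖∫ x, u x * (h.1 x : ℂ) ∂μ‖ₑ ^ 2
      * ENNReal.ofReal (μ.real (H.base h) ^ (-(2 * σ))) < ⊤ := by
  have := hX.sigmaFinite
  have := H.countable hX h𝒟
  obtain ⟨N, hN⟩ := h𝒟.exists_encard_offspring_le hX
  have hdm := h𝒟.measurable_besovDensity hX σ hum
  calc _ ≤ ∑' h : H.functions, ∫⁻ p in H.jumpSet h, besovDensity μ 𝒟 σ u p ∂μ.prod μ :=
        ENNReal.tsum_le_tsum fun h => H.enorm_coeff_sq_mul_rpow_le hX h𝒟 h hum hu σ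
    _ = ∫⁻ p, ∑' h : H.functions, (H.jumpSet h).indicator (besovDensity μ 𝒟 σ u) p ∂μ.prod μ := by
        rw [lintegral_tsum fun h =>
          (hdm.indicator (H.measurableSet_jumpSet h𝒟 h)).aemeasurable]
        exact tsum_congr fun h => (lintegral_indicator (H.measurableSet_jumpSet h𝒟 h) _).symm
    _ ≤ ∫⁻ p, N * besovDensity μ 𝒟 σ u p ∂μ.prod μ := by
        have hgen : ∀ᵐ p : X × X ∂μ.prod μ, ∃ R, IsCubeChain 𝒟 p.1 R :=
          Measure.quasiMeasurePreserving_fst.ae h𝒟.ae_exists_cubeChain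
        refine lintegral_mono_ae (hgen.mono fun p hp => ?_)
        obtain ⟨R, hR⟩ := hp
        exact H.tsum_indicator_jumpSet_le hX h𝒟 hN hR _
    _ < ⊤ := by
        rw [lintegral_const_mul _ hdm]
        exact ENNReal.mul_lt_top (by simp) hB

/-! ### Absolute convergence of the Haar series -/

theorem HaarSystem.ae_tsum_coeff_mul_sq_lt_top (hX : IsHomogeneousType d μ)
    (h𝒟 : IsDyadicFamily d μ 𝒟) (H : HaarSystem μ 𝒟) {w : H.functions → ENNReal}
    (hw : ∑' h, w h < ⊤) : ∀ᵐ x ∂μ, ∑' h : H.functions, w h * ‖h.1 x‖ₑ ^ 2 < ⊤ := by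
  have := H.countable hX h𝒟
  have hm : ∀ h : H.functions, Measurable fun x => w h * ‖h.1 x‖ₑ ^ 2 := fun h =>
    ((H.measurable h).enorm.pow_const 2).const_mul _
  have hone : ∀ h : H.functions, ∫⁻ x, ‖h.1 x‖ₑ ^ 2 ∂μ = 1 := by
    intro h
    have e : ∀ x, ‖h.1 x‖ₑ ^ 2 = ENNReal.ofReal (h.1 x ^ 2) := fun x => by
      rw [← ofReal_norm, ← ENNReal.ofReal_pow (norm_nonneg _), Real.norm_eq_abs, sq_abs]
    simp_rw [e]
    rw [← ofReal_integral_eq_lintegral_ofReal (H.integrable_sq h)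
      (Eventually.of_forall fun x => sq_nonneg _), H.normalized, ENNReal.ofReal_one]
  refine ae_lt_top (Measurable.tsum hm) ?_
  rw [lintegral_tsum fun h => (hm h).aemeasurable]
  simp_rw [lintegral_const_mul _ ((H.measurable _).enorm.pow_const 2), hone, mul_one]
  exact hw.ne

/-- Along the chain of cubes around a point, the powers `μ(Q)^s` of the measures of the cubes that
are the base of some Haar function are summable: each is at most a fixed multiple of the decrease
of `μ(Q)^s` when passing to the next cube. -/
theorem HaarSystem.tsum_rpow_lt_top (hX : IsHomogeneousType d μ) (h𝒟 : IsDyadicFamily d μ 𝒟)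
    (H : HaarSystem μ 𝒟) {s : ℝ} (hs : 0 < s) {x : X} {R : ℤ → Set X}
    (hR : IsCubeChain 𝒟 x R) :
    ∑' h : H.functions, {h : H.functions | 0 ≤ H.scale h ∧ x ∈ H.base h}.indicator
      (fun h => ENNReal.ofReal (μ.real (H.base h) ^ s)) h < ⊤ := by
  classical
  obtain ⟨N, hN⟩ := h𝒟.exists_encard_offspring_le hX
  obtain ⟨θ, hθ0, hθ1, hθ⟩ := h𝒟.exists_offspring_le_mul hX
  have hpos : ∀ i, 0 < μ.real (R i) := fun i => h𝒟.measureReal_pos hX (hR i).1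
  set c : ℕ → ℝ := fun n =>
    if (offspring 𝒟 n (R n)).Nontrivial then μ.real (R n) ^ s else 0 with hc
  have hc0 : ∀ n, 0 ≤ c n := fun n => by
    simp only [hc]
    split_ifs
    exacts [Real.rpow_nonneg (hpos _).le _, le_rfl]
  have hκ : 0 < 1 - θ ^ s := by linarith [Real.rpow_lt_one hθ0 hθ1 hs]
  set b : ℕ → ℝ := fun n => μ.real (R n) ^ s with hb
  have hb0 : ∀ n, 0 ≤ b n := fun n => Real.rpow_nonneg (hpos _).le _
  have hstep : ∀ n, c n ≤ b n / (1 - θ ^ s) - b (n + 1) / (1 - θ ^ s) := by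
    intro n
    have hoff := hR.offspring h𝒟 n
    rw [← sub_div, le_div_iff₀ hκ]
    simp only [hc]
    split_ifs with hnt
    · have h1 := hθ n _ (hR n).1 hnt _ hoff
      have h2 : b (n + 1) ≤ θ ^ s * b n := by
        simp only [hb]
        rw [← Real.mul_rpow hθ0 (hpos _).le]
        push_cast
        exact Real.rpow_le_rpow (hpos _).le h1 hs.le
      simp only [hb] at h2 ⊢
      linarith
    · rw [zero_mul, sub_nonneg]
      simp only [hb]
      push_cast
      exact Real.rpow_le_rpow (hpos _).le (measureReal_mono hoff.2
        (h𝒟.measure_lt_top hX (hR _).1).ne) hs.le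
  have hsum : Summable c := by
    refine summable_of_sum_range_le (c := b 0 / (1 - θ ^ s)) hc0 fun n => ?_
    refine (Finset.sum_le_sum fun i _ => hstep i).trans ?_
    rw [Finset.sum_range_sub' fun n => b n / (1 - θ ^ s)]
    linarith [div_nonneg (hb0 n) hκ.le]
  have hle : ∀ h : H.functions, {h : H.functions | 0 ≤ H.scale h ∧ x ∈ H.base h}.indicator
      (fun h => ENNReal.ofReal (μ.real (H.base h) ^ s)) h
      ≤ ∑' n : ℕ, (H.basedOn n (R n)).indicator (fun _ => ENNReal.ofReal (c n)) h := by
    intro h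
    refine Set.indicator_apply_le' (fun hh => ?_) (fun _ => zero_le)
    have hn : ((H.scale h).toNat : ℤ) = H.scale h := Int.toNat_of_nonneg hh.1
    have hbase : H.base h = R (H.scale h) := hR.eq_of_mem h𝒟 (H.base_mem h) hh.2
    refine le_trans (le_of_eq ?_) (ENNReal.le_tsum (H.scale h).toNat)
    have hmem : h ∈ H.basedOn ((H.scale h).toNat : ℤ) (R ((H.scale h).toNat : ℤ)) := by
      rw [hn]
      exact ⟨rfl, hbase⟩
    have hnt := H.nontrivial_offspring h
    rw [hbase] at hnt
    rw [Set.indicator_of_mem hmem]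
    simp only [hc, hn]
    rw [if_pos hnt, hbase]
  refine (ENNReal.tsum_le_tsum hle).trans_lt ?_
  rw [ENNReal.tsum_comm]
  have hinner : ∀ n : ℕ, ∑' h : H.functions,
      (H.basedOn n (R n)).indicator (fun _ => ENNReal.ofReal (c n)) h
      ≤ N * ENNReal.ofReal (c n) := by
    intro n
    rw [← tsum_subtype, ENNReal.tsum_set_const]
    gcongr
    have := (H.encard_basedOn_le (hR n).1).trans (hN n _ (hR n).1)
    exact_mod_cast ENat.toENNReal_le.2 this
  refine (ENNReal.tsum_le_tsum hinner).trans_lt ?_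
  rw [ENNReal.tsum_mul_left, ← ENNReal.ofReal_tsum_of_nonneg hc0 hsum]
  exact ENNReal.mul_lt_top (by simp) ENNReal.ofReal_lt_top

/-- The Haar series of a Besov function without coefficients of negative scale converges absolutely
almost everywhere. -/
theorem HaarSystem.ae_summable_norm (hX : IsHomogeneousType d μ) (h𝒟 : IsDyadicFamily d μ 𝒟)
    (H : HaarSystem μ 𝒟) {u : X → ℂ} (hum : Measurable u) (hu : MemLp u 2 μ) {σ : ℝ} (hσ : 0 < σ)
    (hB : ∫⁻ p, besovDensity μ 𝒟 σ u p ∂μ.prod μ < ⊤)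
    (hneg : ∀ h : H.functions, H.scale h < 0 → ∫ x, u x * (h.1 x : ℂ) ∂μ = 0) :
    ∀ᵐ x ∂μ, Summable fun h : H.functions => ‖(∫ y, u y * (h.1 y : ℂ) ∂μ) * (h.1 x : ℂ)‖ := by
  have hw := H.tsum_coeff_lt_top hX h𝒟 hum hu hB
  filter_upwards [H.ae_tsum_coeff_mul_sq_lt_top hX h𝒟 hw, h𝒟.ae_exists_cubeChain]
    with x hx ⟨R, hR⟩
  have h2 := H.tsum_rpow_lt_top hX h𝒟 (s := 2 * σ) (by linarith) hR
  have hlt := ENNReal.add_lt_top.2 ⟨hx, h2⟩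
  rw [← ENNReal.tsum_add] at hlt
  set f : H.functions → ℂ := fun h => (∫ y, u y * (h.1 y : ℂ) ∂μ) * (h.1 x : ℂ) with hf
  have hfin : ∑' h, ‖f h‖ₑ < ⊤ := by
    refine (ENNReal.tsum_le_tsum fun h => ?_).trans_lt hlt
    by_cases hh : 0 ≤ H.scale h ∧ x ∈ H.base h
    · rw [Set.indicator_of_mem (by exact hh)]
      set m := μ.real (H.base h) ^ (2 * σ) with hm
      have hm0 : 0 < m := Real.rpow_pos_of_pos (h𝒟.measureReal_pos hX (H.base_mem h)) _
      rw [Real.rpow_neg (h𝒟.measureReal_pos hX (H.base_mem h)).le, ← hm]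
      simp only [hf]
      rw [enorm_mul, enorm_complex_ofReal, ← ofReal_norm, ← ofReal_norm]
      set a := ‖∫ y, u y * (h.1 y : ℂ) ∂μ‖
      rw [← ENNReal.ofReal_pow (norm_nonneg _), ← ENNReal.ofReal_pow (norm_nonneg _),
        ← ENNReal.ofReal_mul (norm_nonneg _), ← ENNReal.ofReal_mul (by positivity),
        ← ENNReal.ofReal_mul (by positivity), ← ENNReal.ofReal_add (by positivity) hm0.le]
      refine ENNReal.ofReal_le_ofReal ?_
      -- `t ≤ t² / m + m`
      have e : a ^ 2 * m⁻¹ * ‖h.1 x‖ ^ 2 + m = ((a * ‖h.1 x‖) ^ 2 + m ^ 2) / m := by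
        field_simp
      rw [e, le_div_iff₀ hm0]
      nlinarith [sq_nonneg (a * ‖h.1 x‖ - m), sq_nonneg (a * ‖h.1 x‖), sq_nonneg m]
    · have h0 : f h = 0 := by
        rcases not_and_or.1 hh with hs | hxb
        · simp only [hf]
          rw [hneg h (not_le.1 hs), zero_mul]
        · simp only [hf]
          rw [H.eq_zero_off h x hxb, Complex.ofReal_zero, mul_zero]
      simp [h0]
  simpa only [toReal_enorm] using ENNReal.summable_toReal hfin.ne

/-! ### Vanishing of the projection -/

theorem integral_mul_eq_zero_of_proj_eq_zero {j : ℤ} {u : Lp ℂ 2 μ} (hP : proj μ 𝒟 j u = 0)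
    {v : X → ℝ} (hv : MemLp v 2 μ)
    (hconst : ∀ Q ∈ 𝒟 j, ∃ c : ℝ, ∀ᵐ x ∂μ.restrict Q, v x = c) :
    ∫ x, u x * (v x : ℂ) ∂μ = 0 := by
  have hvC : MemLp (fun x => (v x : ℂ)) 2 μ := hv.ofReal
  have hmem : hvC.toLp ∈ cubeConst μ 𝒟 j := by
    intro Q hQ
    obtain ⟨c, hc⟩ := hconst Q hQ
    refine ⟨(c : ℂ), ?_⟩
    filter_upwards [hc, ae_restrict_of_ae hvC.coeFn_toLp] with x h1 h2
    rw [h2, h1]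
  have horth := (Submodule.mem_orthogonal _ _).1
    ((Submodule.starProjection_apply_eq_zero_iff _).1 hP) _ hmem
  rw [L2.inner_def] at horth
  rw [← horth]
  refine integral_congr_ae ?_
  filter_upwards [hvC.coeFn_toLp] with x hx
  rw [hx]
  simp

theorem HaarSystem.coeff_eq_zero_of_scale_neg (h𝒟 : IsDyadicFamily d μ 𝒟) (H : HaarSystem μ 𝒟)
    {u : Lp ℂ 2 μ} (hP : proj μ 𝒟 0 u = 0) (h : H.functions) (hs : H.scale h < 0) :
    ∫ x, u x * (h.1 x : ℂ) ∂μ = 0 := by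
  refine integral_mul_eq_zero_of_proj_eq_zero hP (H.memLp h) fun Q hQ => ?_
  have hQm := h𝒟.measurableSet _ _ hQ
  suffices ∃ c : ℝ, ∀ x ∈ Q, h.1 x = c by
    obtain ⟨c, hc⟩ := this
    exact ⟨c, (ae_restrict_mem hQm).mono hc⟩
  rcases h𝒟.nested _ _ hs.le _ (H.base_mem h) Q hQ with hsub | hdisj
  · -- the ancestor `P` of `Q` of scale `j(h) + 1` is a child of `Q(h)`
    obtain ⟨P, hP, hQP⟩ : ∃ P ∈ 𝒟 (H.scale h + 1), Q ⊆ P := by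
      rcases eq_or_lt_of_le (by lia : H.scale h + 1 ≤ 0) with h0 | hlt
      · exact ⟨Q, h0 ▸ hQ, le_rfl⟩
      · obtain ⟨P, hP, -⟩ := h𝒟.parent _ _ hlt Q hQ
        exact ⟨P, hP⟩
    obtain ⟨x₀, hx₀⟩ := h𝒟.nonempty hQ
    have hoff : P ∈ offspring 𝒟 (H.scale h) (H.base h) :=
      ⟨hP, h𝒟.subset_of_mem (by lia) (H.base_mem h) hP (hsub hx₀) (hQP hx₀)⟩
    exact ⟨h.1 x₀, fun x hx => H.const_on_child h P hoff x (hQP hx) x₀ (hQP hx₀)⟩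
  · exact ⟨0, fun x hx => H.eq_zero_off h x (Set.disjoint_left.1 hdisj hx)⟩

theorem IsDyadicFamily.setIntegral_eq_zero_of_proj_eq_zero (h𝒟 : IsDyadicFamily d μ 𝒟)
    (hX : IsHomogeneousType d μ) {j : ℤ} {u : Lp ℂ 2 μ} (hP : proj μ 𝒟 j u = 0) {Q : Set X}
    (hQ : Q ∈ 𝒟 j) : ∫ x in Q, u x ∂μ = 0 := by
  have hQm := h𝒟.measurableSet _ _ hQ
  have h0 := integral_mul_eq_zero_of_proj_eq_zero hP (v := Q.indicator fun _ => (1 : ℝ))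
    (memLp_indicator_const 2 hQm 1 (Or.inr (h𝒟.measure_lt_top hX hQ).ne)) fun R hR => by
      have hRm := h𝒟.measurableSet _ _ hR
      by_cases hRQ : R = Q
      · refine ⟨1, (ae_restrict_mem hRm).mono fun x hx => ?_⟩
        rw [Set.indicator_of_mem (hRQ ▸ hx)]
      · refine ⟨0, (ae_restrict_mem hRm).mono fun x hx => ?_⟩
        rw [Set.indicator_of_notMem (Set.disjoint_left.1 (h𝒟.disjoint j R hR Q hQ hRQ) hx)]
  rw [← h0, ← integral_indicator hQm]
  refine integral_congr_ae (Eventually.of_forall fun x => ?_)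
  by_cases hx : x ∈ Q <;> simp [hx]

/-! ### Convergence of the averages -/

/-- At a point where the Besov density has finite integral, the averages of `u` over the cubes
around the point converge to the value of `u` there: by Jensen, the square of the error is at most
`μ(Q)^{2σ}` times the integral of the density over the cube `Q`. -/
theorem IsCubeChain.tendsto_average (hX : IsHomogeneousType d μ) (h𝒟 : IsDyadicFamily d μ 𝒟)
    {u : X → ℂ} (hum : Measurable u) (hu : MemLp u 2 μ) {σ : ℝ} (hσ : 0 < σ) {x : X}
    {R : ℤ → Set X} (hR : IsCubeChain 𝒟 x R)
    (hfin : ∫⁻ y, besovDensity μ 𝒟 σ u (x, y) ∂μ ≠ ⊤) :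
    Tendsto (fun n : ℕ => ⨍ y in R n, u y ∂μ) atTop (𝓝 (u x)) := by
  have hgm : Measurable fun y => besovDensity μ 𝒟 σ u (x, y) :=
    (h𝒟.measurable_besovDensity hX σ hum).comp measurable_prodMk_left
  have hmeas : ∀ n : ℕ, MeasurableSet (R n) := fun n => h𝒟.measurableSet n _ (hR n).1
  have hpos : ∀ i, 0 < μ.real (R i) := fun i => h𝒟.measureReal_pos hX (hR i).1
  have htop : ∀ i, μ (R i) ≠ ⊤ := fun i => (h𝒟.measure_lt_top hX (hR i).1).ne
  -- the integrals of the density over the cubes tend to zero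
  have hlim : Tendsto (fun n : ℕ => ∫⁻ y in R n, besovDensity μ 𝒟 σ u (x, y) ∂μ) atTop (𝓝 0) := by
    set ν := μ.withDensity fun y => besovDensity μ 𝒟 σ u (x, y) with hν
    have hνfin : IsFiniteMeasure ν := isFiniteMeasure_withDensity hfin
    have hanti : Antitone fun n : ℕ => R n := fun m n hmn => hR.antitone h𝒟 (by exact_mod_cast hmn)
    have h1 := tendsto_measure_iInter_atTop (μ := ν)
      (fun n => (hmeas n).nullMeasurableSet) hanti ⟨0, measure_ne_top _ _⟩
    have hsing : MeasurableSet {x} := by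
      rw [← hR.iInter_nat h𝒟 hX]
      exact MeasurableSet.iInter hmeas
    have h0 : ν {x} = 0 := by
      rw [hν, withDensity_apply _ hsing, setLIntegral_congr_fun hsing (g := fun _ => 0)]
      · simp
      · intro y hy
        rw [Set.mem_singleton_iff.1 hy]
        simp [besovDensity]
    rw [hR.iInter_nat h𝒟 hX, h0] at h1
    refine h1.congr fun n => ?_
    rw [Function.comp_apply, hν, withDensity_apply _ (hmeas n)]
  have hdens : ∀ n : ℕ, ∀ y ∈ R n, ‖u x - u y‖ₑ ^ 2
      ≤ ENNReal.ofReal (μ.real (R n) ^ (1 + 2 * σ)) * besovDensity μ 𝒟 σ u (x, y) := by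
    intro n y hy
    rcases eq_or_ne x y with rfl | hxy
    · simp
    obtain ⟨j, -, hj⟩ := hR.exists_mem_diff h𝒟 hX hxy hy
    have hδpos : 0 < dyadicDist μ 𝒟 x y := by
      rw [h𝒟.dyadicDist_eq hX (hR j).1 (hR.offspring h𝒟 j) (hR (j + 1)).2 hj]
      exact hpos j
    have hδ : dyadicDist μ 𝒟 x y ^ (1 + 2 * σ) ≤ μ.real (R n) ^ (1 + 2 * σ) :=
      Real.rpow_le_rpow hδpos.le (dyadicDist_le (hR n).1 (hR n).2 hy) (by linarith)
    have hδ' : 0 < dyadicDist μ 𝒟 x y ^ (1 + 2 * σ) := Real.rpow_pos_of_pos hδpos _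
    rw [besovDensity, ← ENNReal.ofReal_mul (hδ'.le.trans hδ), ← ofReal_norm,
      ← ENNReal.ofReal_pow (norm_nonneg _)]
    refine ENNReal.ofReal_le_ofReal ?_
    rw [← mul_div_assoc, le_div_iff₀ hδ', mul_comm]
    exact mul_le_mul_of_nonneg_right hδ (sq_nonneg _)
  have herr : ∀ n : ℕ, ‖u x - ⨍ y in R n, u y ∂μ‖ₑ ^ 2
      ≤ ENNReal.ofReal (μ.real (R 0) ^ (2 * σ))
        * ∫⁻ y in R n, besovDensity μ 𝒟 σ u (x, y) ∂μ := by
    intro n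
    have hfinm : IsFiniteMeasure (μ.restrict (R n)) := ⟨by simpa using (htop n).lt_top⟩
    have hui : Integrable u (μ.restrict (R n)) := (hu.restrict _).integrable one_le_two
    have hm0 : μ (R n) ≠ 0 := (h𝒟.measure_pos hX (hR n).1).ne'
    have hdiff : μ.real (R n) • (u x - ⨍ y in R n, u y ∂μ) = ∫ y in R n, (u x - u y) ∂μ := by
      rw [integral_sub (integrable_const _) hui, setIntegral_const, setAverage_eq, smul_sub,
        smul_inv_smul₀ (hpos n).ne']
    have h1 : μ (R n) * ‖u x - ⨍ y in R n, u y ∂μ‖ₑ ≤ ∫⁻ y in R n, ‖u x - u y‖ₑ ∂μ := by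
      calc _ = ‖μ.real (R n) • (u x - ⨍ y in R n, u y ∂μ)‖ₑ := by
            rw [enorm_smul, ← ofReal_norm (μ.real (R n)), Real.norm_of_nonneg (hpos n).le,
              ofReal_measureReal (htop n)]
        _ ≤ _ := by
            rw [hdiff]
            exact enorm_integral_le_lintegral_enorm _
    have hCS := ENNReal.lintegral_mul_le_Lp_mul_Lq (μ.restrict (R n)) Real.HolderConjugate.two_two
      (f := fun y => ‖u x - u y‖ₑ) (g := fun _ => 1)
      (measurable_const.sub hum).enorm.aemeasurable aemeasurable_const
    have h2 : (∫⁻ y in R n, ‖u x - u y‖ₑ ∂μ) ^ 2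
        ≤ (∫⁻ y in R n, ‖u x - u y‖ₑ ^ 2 ∂μ) * μ (R n) := by
      have hsq : ∀ s : ENNReal, (s ^ (1 / 2 : ℝ)) ^ 2 = s := fun s => by
        rw [← ENNReal.rpow_two, ← ENNReal.rpow_mul]
        norm_num
      have := pow_le_pow_left' hCS 2
      rw [mul_pow, hsq, hsq] at this
      simpa using this
    have h3 : μ (R n) * (μ (R n) * ‖u x - ⨍ y in R n, u y ∂μ‖ₑ ^ 2)
        ≤ μ (R n) * ∫⁻ y in R n, ‖u x - u y‖ₑ ^ 2 ∂μ := by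
      have := (pow_le_pow_left' h1 2).trans h2
      rw [mul_pow] at this
      exact le_trans (le_of_eq (by ring)) (this.trans (le_of_eq (by ring)))
    have h4 := (ENNReal.mul_le_mul_iff_right hm0 (htop n)).1 h3
    have h5 : ∫⁻ y in R n, ‖u x - u y‖ₑ ^ 2 ∂μ ≤ μ (R n) *
        (ENNReal.ofReal (μ.real (R n) ^ (2 * σ))
          * ∫⁻ y in R n, besovDensity μ 𝒟 σ u (x, y) ∂μ) := by
      refine (setLIntegral_mono' (hmeas n) (hdens n)).trans (le_of_eq ?_)
      rw [lintegral_const_mul _ hgm, Real.rpow_add (hpos n), Real.rpow_one,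
        ENNReal.ofReal_mul (hpos n).le, ofReal_measureReal (htop n), mul_assoc]
    refine ((ENNReal.mul_le_mul_iff_right hm0 (htop n)).1 (h4.trans h5)).trans ?_
    gcongr
    · exact htop 0
    · exact hR.antitone h𝒟 (by lia)
  have hlim2 : Tendsto (fun n : ℕ => ‖u x - ⨍ y in R n, u y ∂μ‖ₑ ^ 2) atTop (𝓝 0) := by
    refine tendsto_of_tendsto_of_tendsto_of_le_of_le tendsto_const_nhds ?_
      (fun n => zero_le) herr
    simpa using ENNReal.Tendsto.const_mul hlim (Or.inr ENNReal.ofReal_ne_top)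
  rw [tendsto_iff_edist_tendsto_0]
  have hlim3 := (ENNReal.continuous_rpow_const (y := 1 / 2)).tendsto 0 |>.comp hlim2
  rw [ENNReal.zero_rpow_of_pos (by norm_num)] at hlim3
  refine hlim3.congr fun n => ?_
  rw [Function.comp_apply, ← ENNReal.rpow_two, ← ENNReal.rpow_mul, edist_comm, edist_eq_enorm_sub]
  norm_num

/-! ### Pointwise convergence to the initial datum -/

theorem hasSum_of_hasSum_fiber {ι κ : Type*} {f : ι → ℂ} {S : ℂ} (hS : HasSum f S) (s : ι → κ)
    {D : κ → ℂ} (hD : ∀ k, HasSum (fun i : {i // s i = k} => f i) (D k)) : HasSum D S :=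
  HasSum.sigma (f := fun p : Σ k, {i // s i = k} => f p.2)
    ((Equiv.sigmaFiberEquiv s).hasSum_iff.2 hS) hD

/-- Where the Haar series of `u` converges absolutely and the averages of `u` converge to `u`,
the Haar series sums to `u`, since its partial sums are the averages. -/
theorem HaarSystem.hasSum_haar (hX : IsHomogeneousType d μ) (h𝒟 : IsDyadicFamily d μ 𝒟)
    (H : HaarSystem μ 𝒟) {u : X → ℂ} (hu : MemLp u 2 μ)
    (hneg : ∀ h : H.functions, H.scale h < 0 → ∫ x, u x * (h.1 x : ℂ) ∂μ = 0)
    {x : X} {R : ℤ → Set X} (hR : IsCubeChain 𝒟 x R) (hzero : ∫ y in R 0, u y ∂μ = 0)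
    (hsum : Summable fun h : H.functions => (∫ y, u y * (h.1 y : ℂ) ∂μ) * (h.1 x : ℂ))
    (hlim : Tendsto (fun n : ℕ => ⨍ y in R n, u y ∂μ) atTop (𝓝 (u x))) :
    HasSum (fun h : H.functions => (∫ y, u y * (h.1 y : ℂ) ∂μ) * (h.1 x : ℂ)) (u x) := by
  set f : H.functions → ℂ := fun h => (∫ y, u y * (h.1 y : ℂ) ∂μ) * (h.1 x : ℂ) with hf
  obtain ⟨S, hS⟩ := hsum
  set D : ℤ → ℂ := fun j =>
    if 0 ≤ j then (⨍ y in R (j + 1), u y ∂μ) - ⨍ y in R j, u y ∂μ else 0 with hD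
  have hfib : ∀ j : ℤ, HasSum (fun h : {h : H.functions // H.scale h = j} => f h.1) (D j) := by
    intro j
    by_cases hj : 0 ≤ j
    · simp only [hD, if_pos hj]
      exact H.hasSum_scale hX h𝒟 hu (hR j).1 (hR.offspring h𝒟 j) (hR (j + 1)).2
    · simp only [hD, if_neg hj]
      convert hasSum_zero with h
      simp only [hf]
      rw [hneg h.1 (by rw [h.2]; exact not_le.1 hj), zero_mul]
  have hDsum : HasSum D S := hasSum_of_hasSum_fiber hS H.scale hfib
  have hDoff : ∀ j : ℤ, j ∉ Set.range (Nat.cast : ℕ → ℤ) → D j = 0 := fun j hj =>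
    if_neg fun hj0 => hj ⟨j.toNat, Int.toNat_of_nonneg hj0⟩
  have hDnat : HasSum (D ∘ (Nat.cast : ℕ → ℤ)) S :=
    (Nat.cast_injective.hasSum_iff hDoff).2 hDsum
  have hpart : ∀ n : ℕ, ∑ i ∈ Finset.range n, D i = ⨍ y in R n, u y ∂μ := by
    intro n
    have e : ∀ i : ℕ, D i = (fun i : ℕ => ⨍ y in R i, u y ∂μ) (i + 1)
        - (fun i : ℕ => ⨍ y in R i, u y ∂μ) i := fun i => by
      simp [hD]
    simp_rw [e]
    rw [Finset.sum_range_sub (fun i : ℕ => ⨍ y in R i, u y ∂μ)]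
    simp [setAverage_eq, hzero]
  have h1 := hDnat.tendsto_sum_nat
  simp only [Function.comp_apply] at h1
  simp_rw [hpart] at h1
  rw [tendsto_nhds_unique hlim h1]
  exact hS

theorem norm_solTerm (H : HaarSystem μ 𝒟) (β : ℝ) (m : H.functions → ℝ) (u : Lp ℂ 2 μ) (t : ℝ)
    (x : X) (h : H.functions) :
    ‖solTerm H β m u t x h‖ = ‖(∫ y, u y * (h.1 y : ℂ) ∂μ) * (h.1 x : ℂ)‖ := by
  rw [solTerm, mul_assoc, norm_mul, neg_mul, ← mul_neg, ← Complex.ofReal_neg,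
    Complex.norm_exp_I_mul_ofReal, one_mul]

/-- Dominated convergence in the Haar series of the solution, the dominating series being the
one of the initial datum. -/
theorem tendsto_sol (H : HaarSystem μ 𝒟) (β : ℝ) (m : H.functions → ℝ) (u : Lp ℂ 2 μ) {x : X}
    (hsum : Summable fun h : H.functions => ‖(∫ y, u y * (h.1 y : ℂ) ∂μ) * (h.1 x : ℂ)‖) :
    Tendsto (fun t => sol H β m u t x) (𝓝 0)
      (𝓝 (∑' h : H.functions, (∫ y, u y * (h.1 y : ℂ) ∂μ) * (h.1 x : ℂ))) := by
  refine tendsto_tsum_of_dominated_convergence hsum (fun h => ?_)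
    (Eventually.of_forall fun t h => (norm_solTerm H β m u t x h).le)
  have hc : Continuous fun t : ℝ => solTerm H β m u t x h := by
    unfold solTerm
    fun_prop
  simpa [solTerm] using hc.tendsto 0

end DyadicSchrodinger

theorem theorem2 {X : Type*} [MeasurableSpace X] (d : X → X → ℝ) (μ : Measure X)
    (hX : DyadicSchrodinger.IsHomogeneousType d μ)
    (𝒟 : ℤ → Set (Set X)) (h𝒟 : DyadicSchrodinger.IsDyadicFamily d μ 𝒟)
    (hquad : DyadicSchrodinger.IsQuadrant 𝒟)
    (H : DyadicSchrodinger.HaarSystem μ 𝒟)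
    (β lam : ℝ) (hβ : 0 < β) (hβlam : β < lam) (hlam : lam < 1)
    (u₀ : Lp ℂ 2 μ) (hu₀ : DyadicSchrodinger.MemBesov μ 𝒟 lam u₀)
    (hP : DyadicSchrodinger.proj μ 𝒟 0 u₀ = 0) :
    (∃! m : H.functions → ℝ, DyadicSchrodinger.IsHaarMultiplier H β m) ∧
    ∀ m : H.functions → ℝ, DyadicSchrodinger.IsHaarMultiplier H β m →
      (∃ Z : Set X, μ Z = 0 ∧ ∀ x, x ∉ Z → ∀ t ∈ Set.Ico (0 : ℝ) 1,
        Summable (DyadicSchrodinger.solTerm H β m u₀ t x)) ∧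
      (∀ᵐ x ∂μ, Tendsto (fun t : ℝ => DyadicSchrodinger.sol H β m u₀ t x)
        (𝓝[>] 0) (𝓝 (u₀ x))) := by
  have := hX.sigmaFinite
  have hlam0 : 0 < lam := hβ.trans hβlam
  have hum : Measurable u₀ := (Lp.stronglyMeasurable u₀).measurable
  have hu : MemLp u₀ 2 μ := Lp.memLp u₀
  have hneg := H.coeff_eq_zero_of_scale_neg h𝒟 hP
  have hdm := h𝒟.measurable_besovDensity hX lam hum
  have hBprod : ∫⁻ p, DyadicSchrodinger.besovDensity μ 𝒟 lam u₀ p ∂μ.prod μ < ⊤ := by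
    rw [lintegral_prod _ hdm.aemeasurable]
    exact hu₀
  have hsum := H.ae_summable_norm hX h𝒟 hum hu hlam0 hBprod hneg
  refine ⟨H.existsUnique_multiplier hX h𝒟 hquad hβ, fun m _ => ⟨⟨_, hsum, fun x hx t _ => ?_⟩, ?_⟩⟩
  · have hx' : Summable fun h : H.functions =>
        ‖(∫ y, u₀ y * (h.1 y : ℂ) ∂μ) * (h.1 x : ℂ)‖ := by_contra fun hn => hx hn
    exact Summable.of_norm (by simpa only [DyadicSchrodinger.norm_solTerm] using hx')
  · have hfin : ∀ᵐ x ∂μ, ∫⁻ y, DyadicSchrodinger.besovDensity μ 𝒟 lam u₀ (x, y) ∂μ < ⊤ :=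
      ae_lt_top hdm.lintegral_prod_right' hu₀.ne
    filter_upwards [hsum, hfin, h𝒟.ae_exists_cubeChain] with x hx hxfin ⟨R, hR⟩
    have hhas := H.hasSum_haar hX h𝒟 hu hneg hR
      (h𝒟.setIntegral_eq_zero_of_proj_eq_zero hX hP (hR 0).1) hx.of_norm
      (hR.tendsto_average hX h𝒟 hum hu hlam0 hxfin.ne)
    rw [← hhas.tsum_eq]
    exact (DyadicSchrodinger.tendsto_sol H β m u₀ hx).mono_left nhdsWithin_le_nhds
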